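/- **Setting.** An \emph{interval greedoid} is a pair $(E,\mathcal F)$ with $E$ a finite set and $\mathcal F$ a nonempty set of subsets of $E$ such that for all $X,Y,Z\in\mathcal F$: (IG1) if $X\ne\emptyset$ there is $x\in X$ with $X\setminus\{x\}\in\mathcal F$; (IG2) if $|X|>|Y|$ there is $x\in X\setminus Y$ with $Y\cup\{x\}\in\mathcal F$; (IG3) if $X\subseteq Y\subseteq Z$, $e\in E\setminus Z$, $X\cup\{e\}\in\mathcal F$ and $Z\cup\{e\}\in\mathcal F$, then $Y\cup\{e\}\in\mathcal F$. For $X\in\mathcal F$ put $\mathcal F/X=\{Y\subseteq E\setminus X: X\cup Y\in\mathcal F\}$, $X\sim Y$ iff $\mathcal F/X=\mathcal F/Y$, and let $[X]$ be the class of $X$; these classes are the \emph{flats}, forming the set $\Phi$, ordered by $[X]\le[Y]$ iff $Y\cup Z\sim X$ for some $Z\in\mathcal F/Y$ ($\Phi$ is a lattice). Put $\Gamma([X])=\{x\in E\setminus X: X\cup\{x\}\in\mathcal F\}$, $\xi([X])=\bigcup_{X'\sim X}X'$, and, for $S\subseteq E$, $\mu(S)=[X]$ with $X$ maximal among the feasible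 sets contained in $S$. A \emph{covector} of $(E,\mathcal F)$ is a map $\alpha:E\to\{0,+,-,1\}$ for which there is a flat $A$ with $\alpha(e)\in\{+,-\}$ for $e\in\Gamma(A)$, $\alpha(e)=0$ for $e\in\xi(A)$ and $\alpha(e)=1$ otherwise; put $\operatorname{supp}(\alpha)=\mu(\{e:\alpha(e)=0\})$. The map $-\alpha$ is obtained by exchanging $+$ and $-$. Order the symbols by $0<+<1$, $0<-<1$ with $+,-$ incomparable. For covectors $\alpha,\beta$ with supports $A,B$ let $(\alpha\circ\beta)(e)=1$ if $e\notin\Gamma(A\vee B)\cup\xi(A\vee B)$, and otherwise let $(\alpha\circ\beta)(e)=\beta(e)$ if $\beta(e)>\alpha(e)$ and $(\alpha\circ\beta)(e)=\alpha(e)$ if not. Let $S(\alpha,\beta)=\{e:\alpha(e)=-\beta(e)\in\{+,-\}\}$. An \emph{oriented interval greedoid} over an interval greedoid $(E,\mathcal F)$ is a set $\mathcal O$ of covectors of $(E,\mathcal F)$ such that: (OG1) $\operatorname{supp}:\mathcal O\to\Phi$ is surjective; (OG2) $\alpha\in\mathcal O$ implies $-\alpha\in\mathcal O$; (OG3) $\alpha,\beta\in\mathcal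 O$ implies $\alpha\circ\beta\in\mathcal O$; (OG4) if $\alpha,\beta\in\mathcal O$, $x\in S(\alpha,\beta)$ and $(\alpha\circ\beta)(x)\neq1$, then there is $\gamma\in\mathcal O$ with $\gamma(x)=0$ and $\gamma(y)=(\alpha\circ\beta)(y)=(\beta\circ\alpha)(y)$ for every $y\notin S(\alpha,\beta)$ with $(\alpha\circ\beta)(y)\ne1$. **Theorem.** Let $\ell_1,\dots,\ell_n$ be nonzero linear forms on $\mathbb R^d$ whose kernels are pairwise distinct and satisfy $\bigcap_i\ker\ell_i=\{0\}$. Extend each $\ell_i$ to a complex linear form on $\mathbb C^d$, and let $H_i=\{\vec z\in\mathbb C^d:\ell_i(\vec z)=0\}$ (a complexified hyperplane arrangement) and $H_i^\Re=\{\vec z\in\mathbb C^d:\operatorname{Im}\ell_i(\vec z)=0\}$. Let $E_{\mathcal A}=\{H_1,\dots,H_n,H_1^\Re,\dots,H_n^\Re\}$, let $\mathcal L$ be the set of all intersections of members of $E_{\mathcal A}$ (including the empty intersection $\mathbb C^d$), ordered by inclusion, with covering relation $\gtrdot$, and let $\mathcal F_{\mathcal A}$ be the set of all subsets $\{h_1,\dots,h_k\}\subseteq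 E_{\mathcal A}$ with $\mathbb C^d\gtrdot h_1\gtrdot h_1\cap h_2\gtrdot\cdots\gtrdot h_1\cap\cdots\cap h_k$ in $\mathcal L$. For $\vec z\in\mathbb C^d$ define $\alpha_{\vec z}:E_{\mathcal A}\to\{0,+,-,1\}$ as follows: $\alpha_{\vec z}(H_i^\Re)$ is the sign ($+$, $-$ or $0$) of $\operatorname{Im}\ell_i(\vec z)$; $\alpha_{\vec z}(H_i)$ is $1$ if $\operatorname{Im}\ell_i(\vec z)\neq0$, and the sign of $\operatorname{Re}\ell_i(\vec z)$ otherwise. Then: (a) $\mathcal L$ is a finite lower semimodular lattice (if distinct $x,y\in\mathcal L$ are both covered by their join $x\vee y$, then both cover $x\wedge y$), and $E_{\mathcal A}$ is exactly its set of meet-irreducible elements (the elements $e\neq\mathbb C^d$ such that $e=x\wedge y$ implies $x=e$ or $y=e$); (b) $(E_{\mathcal A},\mathcal F_{\mathcal A})$ is an interval greedoid, and $\{\alpha_{\vec z}:\vec z\in\mathbb C^d\}$ is an oriented interval greedoid over $(E_{\mathcal A},\mathcal F_{\mathcal A})$. -/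

import Mathlib

/-! ### The four symbols `0, +, -, 1` -/

/-- The symbols that occur as values of covectors. -/
inductive CovSign : Type
  | zero
  | plus
  | minus
  | one
  deriving DecidableEq

namespace CovSign

/-- The order with bottom element `0`, top element `1`, and `+`, `-` incomparable in between. -/
instance : PartialOrder CovSign where
  le a b := a = b ∨ a = zero ∨ b = one
  le_refl _ := Or.inl rfl
  le_trans a b c := by cases a <;> cases b <;> cases c <;> simp
  le_antisymm a b := by cases a <;> cases b <;> simp

/-- Exchange `+` and `-`, keeping `0` and `1`. -/
instance : Neg CovSign where
  neg a := match a with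
    | zero => zero
    | plus => minus
    | minus => plus
    | one => one

end CovSign

/-! ### Interval greedoids and their flats -/

namespace IntervalGreedoid

variable {E : Type*}

/-- `(E, F)` is an interval greedoid, where the ground set is the whole type `E`. -/
structure IsIntervalGreedoid (F : Set (Set E)) : Prop where
  finite_ground : Finite E
  nonempty : F.Nonempty
  accessible : ∀ X ∈ F, X ≠ ∅ → ∃ x ∈ X, X \ {x} ∈ F
  exchange : ∀ X ∈ F, ∀ Y ∈ F, Y.ncard < X.ncard → ∃ x ∈ X \ Y, insert x Y ∈ F
  interval : ∀ X ∈ F, ∀ Y ∈ F, ∀ Z ∈ F, X ⊆ Y → Y ⊆ Z →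
    ∀ e, e ∉ Z → insert e X ∈ F → insert e Z ∈ F → insert e Y ∈ F

/-- The contraction `F / X`: the sets disjoint from `X` whose union with `X` is feasible. -/
def contraction (F : Set (Set E)) (X : Set E) : Set (Set E) :=
  {Y | Disjoint Y X ∧ X ∪ Y ∈ F}

/-- The class `[X] = {Y ∈ F | F / Y = F / X}`. -/
def flatOf (F : Set (Set E)) (X : Set E) : Set (Set E) :=
  {Y | Y ∈ F ∧ contraction F Y = contraction F X}

/-- The set of flats: the classes `[X]` of feasible sets `X`. -/
def flats (F : Set (Set E)) : Set (Set (Set E)) :=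
  {A | ∃ X ∈ F, A = flatOf F X}

/-- The order of flats: `[X] ≤ [Y]` iff `Y ∪ Z ∼ X` for some `Z ∈ F / Y`. -/
def FlatLE (F : Set (Set E)) (A B : Set (Set E)) : Prop :=
  ∃ X ∈ A, ∃ Y ∈ B, ∃ Z ∈ contraction F Y, contraction F (Y ∪ Z) = contraction F X

/-- `C` is the least upper bound of `A` and `B` in the poset of flats. -/
def IsFlatJoin (F : Set (Set E)) (A B C : Set (Set E)) : Prop :=
  C ∈ flats F ∧ FlatLE F A C ∧ FlatLE F B C ∧
    ∀ D ∈ flats F, FlatLE F A D → FlatLE F B D → FlatLE F C D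

/-- The join `A ∨ B` of two flats. For an interval greedoid there is exactly one flat `C` with
`IsFlatJoin F A B C`, and this set is equal to it. -/
def flatJoin (F : Set (Set E)) (A B : Set (Set E)) : Set (Set E) :=
  {Y | ∃ C, IsFlatJoin F A B C ∧ Y ∈ C}

/-- The continuations `Γ(A)` of a flat `A = [X]`: the elements outside `X` whose addition to `X`
is feasible. (This depends only on `A`.) -/
def continuations (F : Set (Set E)) (A : Set (Set E)) : Set E :=
  {x | ∃ X ∈ A, x ∉ X ∧ insert x X ∈ F}

/-- `ξ(A)`: the union of the feasible sets in the flat `A`. -/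
def xi (A : Set (Set E)) : Set E := ⋃₀ A

/-- `μ(S) = [X]`, where `X` is maximal among the feasible sets contained in `S`. For an interval
greedoid all such `X` belong to the same class, and this set is equal to it. -/
def mu (F : Set (Set E)) (S : Set E) : Set (Set E) :=
  {Y | ∃ X, Maximal (fun W : Set E => W ∈ F ∧ W ⊆ S) X ∧ Y ∈ flatOf F X}

/-! ### Signed flats and covectors -/

/-- A flat `A` with a map from `Γ(A)` to `{+, -}`. -/
structure SignedFlat (F : Set (Set E)) where
  flat : Set (Set E)
  flat_mem : flat ∈ flats F
  sign : ↥(continuations F flat) → {s : CovSign // s = CovSign.plus ∨ s = CovSign.minus}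

open Classical in
/-- The covector of a signed flat. -/
noncomputable def SignedFlat.covector {F : Set (Set E)} (A : SignedFlat F) : E → CovSign :=
  fun e =>
    if h : e ∈ continuations F A.flat then (A.sign ⟨e, h⟩).1
    else if e ∈ xi A.flat then CovSign.zero
    else CovSign.one

/-- The set of all covectors of `(E, F)`. -/
def covectors (F : Set (Set E)) : Set (E → CovSign) :=
  {α | ∃ A : SignedFlat F, A.covector = α}

/-- The support of a covector. -/
def supp (F : Set (Set E)) (α : E → CovSign) : Set (Set E) :=
  mu F {x | α x = CovSign.zero}

open Classical in
/-- The auxiliary product `α ⋆ β`. -/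
noncomputable def star (α β : E → CovSign) : E → CovSign :=
  fun e => if α e < β e then β e else α e

open Classical in
/-- The product `α ∘ β` of two covectors. -/
noncomputable def comp (F : Set (Set E)) (α β : E → CovSign) : E → CovSign :=
  fun e =>
    if e ∈ continuations F (flatJoin F (supp F α) (supp F β)) ∪
        xi (flatJoin F (supp F α) (supp F β))
    then star α β e
    else CovSign.one

/-- The separation set of two covectors. -/
def separationSet (α β : E → CovSign) : Set E :=
  {e | α e = -β e ∧ (α e = CovSign.plus ∨ α e = CovSign.minus)}

/-- `(E, F, O)` is an oriented interval greedoid. -/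
structure IsOrientedIntervalGreedoid (F : Set (Set E)) (O : Set (E → CovSign)) : Prop where
  isIntervalGreedoid : IsIntervalGreedoid F
  subset_covectors : O ⊆ covectors F
  supp_surjective : ∀ A ∈ flats F, ∃ α ∈ O, supp F α = A
  neg_mem : ∀ α ∈ O, -α ∈ O
  comp_mem : ∀ α ∈ O, ∀ β ∈ O, comp F α β ∈ O
  elimination : ∀ α ∈ O, ∀ β ∈ O, ∀ x ∈ separationSet α β, comp F α β x ≠ CovSign.one →
    ∃ γ ∈ O, γ x = CovSign.zero ∧
      ∀ y, y ∉ separationSet α β → comp F α β y ≠ CovSign.one →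
        γ y = comp F α β y ∧ comp F α β y = comp F β α y

end IntervalGreedoid

/-! ### Complexified hyperplane arrangements -/

/-- An (essential) arrangement of `n` distinct linear hyperplanes in `ℝ^d`, with a linear form
chosen for each hyperplane. -/
structure RealArrangement (d n : ℕ) where
  form : Fin n → ((Fin d → ℝ) →ₗ[ℝ] ℝ)
  form_ne_zero : ∀ i, form i ≠ 0
  ker_injective : Function.Injective fun i => LinearMap.ker (form i)
  essential : ⨅ i, LinearMap.ker (form i) = ⊥

namespace RealArrangement

variable {d n : ℕ} (𝒜 : RealArrangement d n)

/-- The extension of the form `ℓ_i` to a complex linear form on `ℂ^d`. -/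
noncomputable def complexForm (i : Fin n) : (Fin d → ℂ) →ₗ[ℂ] ℂ where
  toFun z := (𝒜.form i (fun j => (z j).re) : ℂ) + (𝒜.form i (fun j => (z j).im) : ℂ) * Complex.I
  map_add' z w := by
    have h1 : (fun j => ((z + w) j).re) = (fun j => (z j).re) + fun j => (w j).re := by
      ext j; simp
    have h2 : (fun j => ((z + w) j).im) = (fun j => (z j).im) + fun j => (w j).im := by
      ext j; simp
    rw [h1, h2, map_add, map_add]
    push_cast
    ring
  map_smul' c z := by
    have h1 : (fun j => ((c • z) j).re) =
        c.re • (fun j => (z j).re) - c.im • fun j => (z j).im := by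
      ext j; simp
    have h2 : (fun j => ((c • z) j).im) =
        c.re • (fun j => (z j).im) + c.im • fun j => (z j).re := by
      ext j; simp
    rw [h1, h2, map_sub, map_add, map_smul, map_smul, map_smul, map_smul]
    apply Complex.ext <;> simp

/-- The hyperplane `H_i ⊆ ℂ^d`, as a real subspace. -/
noncomputable def H (i : Fin n) : Submodule ℝ (Fin d → ℂ) :=
  (LinearMap.ker (𝒜.complexForm i)).restrictScalars ℝ

/-- The real hypersurface `H_i^ℜ = {z | Im (ℓ_i z) = 0}`. -/
noncomputable def HRe (i : Fin n) : Submodule ℝ (Fin d → ℂ) :=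
  LinearMap.ker (Complex.imLm ∘ₗ (𝒜.complexForm i).restrictScalars ℝ)

/-- The ground set `{H_1, …, H_n, H_1^ℜ, …, H_n^ℜ}`. -/
def ground : Set (Submodule ℝ (Fin d → ℂ)) :=
  Set.range 𝒜.H ∪ Set.range 𝒜.HRe

/-- The lattice of all intersections of members of the ground set, ordered by inclusion. The empty
intersection is `ℂ^d`. -/
def IntersectionLattice : Type :=
  {M : Submodule ℝ (Fin d → ℂ) // ∃ S ⊆ 𝒜.ground, M = sInf S}

instance : PartialOrder 𝒜.IntersectionLattice :=
  inferInstanceAs (PartialOrder {M : Submodule ℝ (Fin d → ℂ) // ∃ S ⊆ 𝒜.ground, M = sInf S})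

/-- Infima in the intersection lattice are intersections. -/
noncomputable instance : InfSet 𝒜.IntersectionLattice where
  sInf T := ⟨sInf (Subtype.val '' T), {h | h ∈ 𝒜.ground ∧ ∃ M ∈ T, M.1 ≤ h},
    fun _ h => h.1, by
      apply le_antisymm
      · refine le_sInf fun h hh => ?_
        obtain ⟨_, M, hM, hle⟩ := hh
        exact (sInf_le (Set.mem_image_of_mem _ hM)).trans hle
      · refine le_sInf fun N hN => ?_
        obtain ⟨M, hM, rfl⟩ := hN
        obtain ⟨S, hS, hMS⟩ := M.2
        rw [hMS]
        refine le_sInf fun h hh => sInf_le ⟨hS hh, M, hM, ?_⟩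
        rw [hMS]
        exact sInf_le hh⟩

noncomputable instance : CompleteLattice 𝒜.IntersectionLattice :=
  completeLatticeOfInf _ fun T =>
    ⟨fun M hM => (sInf_le (Set.mem_image_of_mem _ hM) : sInf (Subtype.val '' T) ≤ M.1),
     fun N hN => (le_sInf (by rintro _ ⟨M, hM, rfl⟩; exact hN hM) :
       N.1 ≤ sInf (Subtype.val '' T))⟩

/-- A member of the ground set, as an element of the intersection lattice. -/
def toLattice (h : 𝒜.ground) : 𝒜.IntersectionLattice :=
  ⟨h.1, {h.1}, Set.singleton_subset_iff.2 h.2, by simp⟩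

/-- The feasible sets: the sets `{h_1, …, h_k}` of members of the ground set such that
`ℂ^d ⋗ h_1 ⋗ h_1 ∩ h_2 ⋗ ⋯ ⋗ h_1 ∩ ⋯ ∩ h_k` in the intersection lattice. -/
def feasible : Set (Set 𝒜.ground) :=
  {X | ∃ (k : ℕ) (h : Fin k → 𝒜.ground), X = Set.range h ∧
    ∀ j : Fin k, (⨅ i : Fin k, ⨅ _ : i ≤ j, 𝒜.toLattice (h i)) ⋖
      (⨅ i : Fin k, ⨅ _ : i < j, 𝒜.toLattice (h i))}

/-- The sign function `σ_ℜ`. -/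
noncomputable def sigmaRe (w : ℂ) : CovSign :=
  if w.im ≠ 0 then CovSign.one
  else if 0 < w.re then CovSign.plus
  else if w.re < 0 then CovSign.minus
  else CovSign.zero

/-- The sign function `σ_ℑ`. -/
noncomputable def sigmaIm (w : ℂ) : CovSign :=
  if 0 < w.im then CovSign.plus
  else if w.im < 0 then CovSign.minus
  else CovSign.zero

open Classical in
/-- The sign vector `α_z`: its value at `H_i^ℜ` is `σ_ℑ (ℓ_i z)` and its value at `H_i` is
`σ_ℜ (ℓ_i z)`; see `signVector_HRe` and `signVector_H`. -/
noncomputable def signVector (z : Fin d → ℂ) (h : 𝒜.ground) : CovSign :=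
  if hr : h.1 ∈ Set.range 𝒜.HRe then sigmaIm (𝒜.complexForm hr.choose z)
  else sigmaRe (𝒜.complexForm (h.2.resolve_right hr).choose z)

theorem real_mem_HRe (i : Fin n) (x : Fin d → ℝ) : (fun j => (x j : ℂ)) ∈ 𝒜.HRe i := by
  have h0 : 𝒜.form i (fun _ => 0) = 0 := map_zero _
  simp [HRe, complexForm, h0]

theorem real_mem_H_iff (i : Fin n) (x : Fin d → ℝ) :
    (fun j => (x j : ℂ)) ∈ 𝒜.H i ↔ 𝒜.form i x = 0 := by
  have h0 : 𝒜.form i (fun _ => 0) = 0 := map_zero _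
  simp [H, complexForm, h0]

theorem H_injective : Function.Injective 𝒜.H := by
  intro i j hij
  apply 𝒜.ker_injective
  ext x
  simp only [LinearMap.mem_ker]
  rw [← 𝒜.real_mem_H_iff, ← 𝒜.real_mem_H_iff, hij]

theorem imag_mem_HRe_iff (i : Fin n) (x : Fin d → ℝ) :
    (fun j => (x j : ℂ) * Complex.I) ∈ 𝒜.HRe i ↔ 𝒜.form i x = 0 := by
  simp [HRe, complexForm]

theorem HRe_injective : Function.Injective 𝒜.HRe := by
  intro i j hij
  apply 𝒜.ker_injective
  ext x
  simp only [LinearMap.mem_ker]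
  rw [← 𝒜.imag_mem_HRe_iff, ← 𝒜.imag_mem_HRe_iff, hij]

theorem H_ne_HRe (i j : Fin n) : 𝒜.H i ≠ 𝒜.HRe j := by
  intro h
  apply 𝒜.form_ne_zero i
  apply LinearMap.ext
  intro x
  have hx := 𝒜.real_mem_HRe j x
  rw [← h] at hx
  exact (𝒜.real_mem_H_iff i x).1 hx

theorem signVector_HRe (z : Fin d → ℂ) (i : Fin n) :
    𝒜.signVector z ⟨𝒜.HRe i, Or.inr ⟨i, rfl⟩⟩ = sigmaIm (𝒜.complexForm i z) := by
  have hr : 𝒜.HRe i ∈ Set.range 𝒜.HRe := ⟨i, rfl⟩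
  rw [signVector, dif_pos hr, 𝒜.HRe_injective hr.choose_spec]

theorem signVector_H (z : Fin d → ℂ) (i : Fin n) :
    𝒜.signVector z ⟨𝒜.H i, Or.inl ⟨i, rfl⟩⟩ = sigmaRe (𝒜.complexForm i z) := by
  have hr : 𝒜.H i ∉ Set.range 𝒜.HRe := fun ⟨j, hj⟩ => 𝒜.H_ne_HRe i j hj.symm
  have hc : 𝒜.H i ∈ Set.range 𝒜.H := ⟨i, rfl⟩
  rw [signVector, dif_neg hr, 𝒜.H_injective hc.choose_spec]

end RealArrangement

/-!
Write `z = x + iy`. A member of the ground set imposes either `ℓ_i(y) = 0` (for `H_i^ℜ`) or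
`ℓ_i(x) = ℓ_i(y) = 0` (for `H_i`), so everything reduces to linear algebra with the real forms
`ℓ_i`.

*The lattice.* Given an intersection `N` not contained in `H_i`, cutting it with `H_i^ℜ` or, if
`N ⊆ H_i^ℜ`, with `H_i` lowers the real dimension by one. Hence a covering in the intersection
lattice is a covering in the modular lattice of all real subspaces (`covBy_iff_toSubmodule`), and
lower semimodularity is inherited from there. The intersections containing `H_i` are
`H_i ⊂ H_i^ℜ ⊂ ℂ^d`, because distinct forms have distinct kernels; so every member of the ground
set is meet-irreducible, and nothing else is, since every other element is a finite meet of these.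

*The greedoid.* Encode a set `X` by the index sets `I = {i | H_i ∈ X}` and
`J = {j | H_j^ℜ ∈ X}`. Then `X` is feasible if and only if `I` and `J` are independent in the
linear matroid of the forms and `I` lies in the closure of `J` (`mem_feasible_iff`): adding
`H_j^ℜ` is a covering exactly if `j` is not in the closure of `J`, and adding `H_i` is one exactly
if `i` is in the closure of `J` but not in that of `I` (`IsIndepPair.meet_insert_covBy_iff`). The
axioms of an interval greedoid follow from exchange in the matroid, and two feasible sets define
the same flat if and only if their closures agree (`IsIndepPair.contraction_eq_iff`).

*Orientation.* Closed sets of indices are zero sets of generic points, so each flat is `flatAt z`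
for some point `z`: its two closures are the sets of `i` with `z ∈ H_i` and with `z ∈ H_i^ℜ`. The
order of flats is reverse inclusion of these zero sets, and the join is given by their
intersections. Hence the support of the sign vector of `z` is `flatAt z`, and the composition of the
sign vectors of `z` and `w` is the sign vector of `z + εw` for small `ε > 0`. For elimination at
`e`, choose `t > 0` such that the sign of `z + tw` at `e` vanishes; the signs of `z + tw`
outside the separation set are those of the composition wherever the latter is not `1`.
-/

/-! ### The closure operator of a family of vectors -/

section SpanClosure

variable {ι K V : Type*} [Field K] [AddCommGroup V] [Module K V]

/-- The indices of the vectors of the family `v` that lie in the span of the vectors with index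
in `S`: the closure of `S` in the linear matroid represented by `v`. -/
def spanClosure (K : Type*) {ι V : Type*} [Field K] [AddCommGroup V] [Module K V]
    (v : ι → V) (S : Set ι) : Set ι :=
  {i | v i ∈ Submodule.span K (v '' S)}

theorem subset_spanClosure (v : ι → V) (S : Set ι) : S ⊆ spanClosure K v S :=
  fun _ hi => Submodule.subset_span (Set.mem_image_of_mem v hi)

theorem span_image_spanClosure (v : ι → V) (S : Set ι) :
    Submodule.span K (v '' spanClosure K v S) = Submodule.span K (v '' S) := by
  apply le_antisymm
  · rw [Submodule.span_le]
    rintro _ ⟨i, hi, rfl⟩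
    exact hi
  · exact Submodule.span_mono (Set.image_mono (subset_spanClosure v S))

theorem span_image_le_of_subset_spanClosure {v : ι → V} {S T : Set ι}
    (h : S ⊆ spanClosure K v T) :
    Submodule.span K (v '' S) ≤ Submodule.span K (v '' T) := by
  rw [← span_image_spanClosure v T]
  exact Submodule.span_mono (Set.image_mono h)

theorem spanClosure_subset_iff {v : ι → V} {S T : Set ι} :
    spanClosure K v S ⊆ spanClosure K v T ↔ S ⊆ spanClosure K v T :=
  ⟨(subset_spanClosure v S).trans, fun h _ hi => span_image_le_of_subset_spanClosure h hi⟩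

theorem spanClosure_mono (v : ι → V) {S T : Set ι} (h : S ⊆ T) :
    spanClosure K v S ⊆ spanClosure K v T :=
  spanClosure_subset_iff.2 (h.trans (subset_spanClosure v T))

theorem span_image_eq_of_spanClosure_eq {v : ι → V} {S T : Set ι}
    (h : spanClosure K v S = spanClosure K v T) :
    Submodule.span K (v '' S) = Submodule.span K (v '' T) := by
  rw [← span_image_spanClosure v S, h, span_image_spanClosure]

theorem spanClosure_union_congr {v : ι → V} {S T : Set ι} (U : Set ι)
    (h : spanClosure K v S = spanClosure K v T) :
    spanClosure K v (S ∪ U) = spanClosure K v (T ∪ U) := by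
  ext i
  simp only [spanClosure, Set.mem_ofPred_eq, Set.image_union, Submodule.span_union,
    span_image_eq_of_spanClosure_eq h]

theorem LinearIndepOn.exists_spanClosure_eq {v : ι → V} {S T : Set ι} (hS : LinearIndepOn K v S)
    (hST : S ⊆ T) :
    ∃ B, S ⊆ B ∧ B ⊆ T ∧ LinearIndepOn K v B ∧ spanClosure K v B = spanClosure K v T := by
  obtain ⟨B, hBT, hSB, hT, hB⟩ := exists_linearIndepOn_extension hS hST
  exact ⟨B, hSB, hBT, hB, (spanClosure_mono v hBT).antisymm
    (spanClosure_subset_iff.2 fun i hi => hT (Set.mem_image_of_mem v hi))⟩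

theorem LinearIndepOn.ncard_le_ncard [Finite ι] {v : ι → V} {S T : Set ι}
    (hS : LinearIndepOn K v S) (hT : LinearIndepOn K v T) (h : S ⊆ spanClosure K v T) :
    S.ncard ≤ T.ncard := by
  have key (U : Set ι) (hU : LinearIndepOn K v U) :
      Module.finrank K (Submodule.span K (v '' U)) = U.ncard := by
    have := Fintype.ofFinite U
    rw [Set.image_eq_range, finrank_span_eq_card hU, ← Nat.card_eq_fintype_card,
      Nat.card_coe_set_eq]
  have : FiniteDimensional K (Submodule.span K (v '' T)) :=
    FiniteDimensional.span_of_finite K (T.toFinite.image v)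
  rw [← key S hS, ← key T hT]
  exact Submodule.finrank_mono (span_image_le_of_subset_spanClosure h)

/-- The sets that extend an independent set depend only on its closure. -/
theorem LinearIndepOn.union_of_spanClosure_eq {v : ι → V} {S T U : Set ι}
    (hT : LinearIndepOn K v T) (h : spanClosure K v S = spanClosure K v T)
    (hU : Disjoint U S) (hSU : LinearIndepOn K v (S ∪ U)) :
    Disjoint U T ∧ LinearIndepOn K v (T ∪ U) := by
  obtain ⟨-, hUi, hd⟩ := (linearIndepOn_union_iff hU.symm).1 hSU
  rw [span_image_eq_of_spanClosure_eq h] at hd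
  have hUT : Disjoint U T := by
    rw [Set.disjoint_left]
    intro i hiU hiT
    refine hUi.ne_zero hiU ?_
    exact Submodule.disjoint_def.1 hd _ (Submodule.subset_span (Set.mem_image_of_mem v hiT))
      (Submodule.subset_span (Set.mem_image_of_mem v hiU))
  exact ⟨hUT, (linearIndepOn_union_iff hUT.symm).2 ⟨hT, hUi, hd⟩⟩

/-- The zero set of a point in a family of linear forms is closed. -/
theorem spanClosure_setOf_apply_eq_zero (v : ι → V →ₗ[K] K) (y : V) :
    spanClosure K v {i | v i y = 0} = {i | v i y = 0} := by
  refine Set.Subset.antisymm (fun i hi => ?_) (subset_spanClosure v _)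
  have : Submodule.span K (v '' {i | v i y = 0}) ≤
      LinearMap.ker (LinearMap.applyₗ (R := K) (M₂ := K) y) := by
    rw [Submodule.span_le]
    rintro _ ⟨j, hj, rfl⟩
    exact hj
  exact this hi

/-- Duality: a form outside the span of finitely many others takes a nonzero value at one of
their common zeros. -/
theorem exists_apply_ne_zero_of_notMem_spanClosure [Finite ι] {v : ι → V →ₗ[K] K} {S : Set ι}
    {i : ι} (hi : i ∉ spanClosure K v S) : ∃ y, (∀ j ∈ S, v j y = 0) ∧ v i y ≠ 0 := by
  by_contra! h
  apply hi
  have := mem_span_of_iInf_ker_le_ker (L := fun j : S => v j) (K := v i) fun y hy => by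
    simp only [Submodule.mem_iInf, LinearMap.mem_ker, Subtype.forall] at hy
    exact h y hy
  rwa [← Set.image_eq_range] at this

/-- Over an infinite field, every closed set of indices is the zero set of a point, namely of a
generic common zero. -/
theorem exists_setOf_apply_eq_zero_eq_spanClosure [Finite ι] [Infinite K] (v : ι → V →ₗ[K] K)
    (S : Set ι) : ∃ y, {i | v i y = 0} = spanClosure K v S := by
  obtain ⟨y, hyS, hy⟩ := Module.Dual.exists_forall_mem_ne_zero_of_forall_exists
    (⨅ j : S, LinearMap.ker (v j)) (fun i : ↥(spanClosure K v S)ᶜ => v i) fun i => by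
      obtain ⟨y, hyS, hy⟩ := exists_apply_ne_zero_of_notMem_spanClosure i.2
      exact ⟨y, by simpa [Submodule.mem_iInf] using hyS, hy⟩
  simp only [Submodule.mem_iInf, LinearMap.mem_ker, Subtype.forall] at hyS
  refine ⟨y, Set.Subset.antisymm (fun i hi => ?_) ?_⟩
  · by_contra hc
    exact hy ⟨i, hc⟩ hi
  · rw [← spanClosure_setOf_apply_eq_zero v y]
    exact spanClosure_mono v hyS

/-- The kernel of a linear form cuts a subspace that it does not contain in a hyperplane. -/
theorem inf_ker_covBy {N : Submodule K V} {f : V →ₗ[K] K} (h : ¬ N ≤ LinearMap.ker f) :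
    N ⊓ LinearMap.ker f ⋖ N := by
  have hf : f ≠ 0 := by
    rintro rfl
    exact h (by simp)
  have hc := LinearMap.isCoatom_ker_of_surjective (LinearMap.surjective hf)
  have hs : N ⊔ LinearMap.ker f = ⊤ :=
    hc.2 _ (lt_of_le_of_ne le_sup_right fun he => h (le_sup_left.trans he.ge))
  apply inf_covBy_of_covBy_sup_right
  rw [hs]
  exact covBy_top_iff.2 hc

end SpanClosure

/-! ### The intersection lattice -/

namespace RealArrangement

variable {d n : ℕ} (𝒜 : RealArrangement d n)

/-- The real part of the form `ℓ_i` on `ℂ^d`. -/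
noncomputable def reForm (i : Fin n) : (Fin d → ℂ) →ₗ[ℝ] ℝ :=
  Complex.reLm ∘ₗ (𝒜.complexForm i).restrictScalars ℝ

/-- The imaginary part of the form `ℓ_i` on `ℂ^d`. -/
noncomputable def imForm (i : Fin n) : (Fin d → ℂ) →ₗ[ℝ] ℝ :=
  Complex.imLm ∘ₗ (𝒜.complexForm i).restrictScalars ℝ

theorem reForm_apply (i : Fin n) (z : Fin d → ℂ) :
    𝒜.reForm i z = 𝒜.form i fun j => (z j).re := by
  simp [reForm, complexForm]

theorem imForm_apply (i : Fin n) (z : Fin d → ℂ) :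
    𝒜.imForm i z = 𝒜.form i fun j => (z j).im := by
  simp [imForm, complexForm]

theorem complexForm_re (i : Fin n) (z : Fin d → ℂ) : (𝒜.complexForm i z).re = 𝒜.reForm i z := rfl

theorem complexForm_im (i : Fin n) (z : Fin d → ℂ) : (𝒜.complexForm i z).im = 𝒜.imForm i z := rfl

theorem HRe_eq_ker (i : Fin n) : 𝒜.HRe i = LinearMap.ker (𝒜.imForm i) := rfl

theorem H_eq_inf_ker (i : Fin n) :
    𝒜.H i = LinearMap.ker (𝒜.imForm i) ⊓ LinearMap.ker (𝒜.reForm i) := by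
  ext z
  simp only [H, Submodule.restrictScalars_mem, LinearMap.mem_ker, Submodule.mem_inf,
    ← complexForm_re, ← complexForm_im, Complex.ext_iff, Complex.zero_re, Complex.zero_im]
  exact and_comm

theorem mem_H {i : Fin n} {z : Fin d → ℂ} :
    z ∈ 𝒜.H i ↔ 𝒜.imForm i z = 0 ∧ 𝒜.reForm i z = 0 := by
  rw [H_eq_inf_ker]
  rfl

theorem mem_HRe {i : Fin n} {z : Fin d → ℂ} : z ∈ 𝒜.HRe i ↔ 𝒜.imForm i z = 0 := Iff.rfl

theorem H_le_HRe (i : Fin n) : 𝒜.H i ≤ 𝒜.HRe i := fun _ hz => (𝒜.mem_H.1 hz).1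

/-- `H_i` as a member of the ground set. -/
noncomputable def groundH (i : Fin n) : 𝒜.ground := ⟨𝒜.H i, Or.inl ⟨i, rfl⟩⟩

/-- `H_i^ℜ` as a member of the ground set. -/
noncomputable def groundHRe (i : Fin n) : 𝒜.ground := ⟨𝒜.HRe i, Or.inr ⟨i, rfl⟩⟩

theorem forall_ground {p : 𝒜.ground → Prop} :
    (∀ e, p e) ↔ (∀ i, p (𝒜.groundH i)) ∧ ∀ i, p (𝒜.groundHRe i) := by
  refine ⟨fun h => ⟨fun i => h _, fun i => h _⟩, fun h e => ?_⟩
  obtain ⟨_, ⟨i, rfl⟩ | ⟨i, rfl⟩⟩ := e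
  exacts [h.1 i, h.2 i]

theorem groundH_inj {i j : Fin n} : 𝒜.groundH i = 𝒜.groundH j ↔ i = j :=
  ⟨fun h => 𝒜.H_injective (congrArg Subtype.val h), congrArg _⟩

theorem groundHRe_inj {i j : Fin n} : 𝒜.groundHRe i = 𝒜.groundHRe j ↔ i = j :=
  ⟨fun h => 𝒜.HRe_injective (congrArg Subtype.val h), congrArg _⟩

theorem groundH_ne_groundHRe (i j : Fin n) : 𝒜.groundH i ≠ 𝒜.groundHRe j :=
  fun h => 𝒜.H_ne_HRe i j (congrArg Subtype.val h)

theorem groundHRe_ne_groundH (i j : Fin n) : 𝒜.groundHRe i ≠ 𝒜.groundH j :=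
  (𝒜.groundH_ne_groundHRe j i).symm

theorem finite_ground : 𝒜.ground.Finite :=
  (Set.finite_range _).union (Set.finite_range _)

instance : Finite 𝒜.ground := 𝒜.finite_ground

variable {𝒜}

/-- An element of the intersection lattice as a real subspace of `ℂ^d`. -/
def IntersectionLattice.toSubmodule (M : 𝒜.IntersectionLattice) : Submodule ℝ (Fin d → ℂ) := M.1

open IntersectionLattice

theorem toSubmodule_injective :
    Function.Injective (toSubmodule : 𝒜.IntersectionLattice → Submodule ℝ (Fin d → ℂ)) :=
  Subtype.val_injective

theorem exists_toSubmodule_eq_sInf (M : 𝒜.IntersectionLattice) :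
    ∃ S ⊆ 𝒜.ground, M.toSubmodule = sInf S := M.2

theorem toSubmodule_inf (M N : 𝒜.IntersectionLattice) :
    (M ⊓ N).toSubmodule = M.toSubmodule ⊓ N.toSubmodule := by
  apply le_antisymm
  · exact le_inf (inf_le_left : M ⊓ N ≤ M) (inf_le_right : M ⊓ N ≤ N)
  · refine le_sInf ?_
    rintro _ ⟨P, rfl | rfl, rfl⟩
    exacts [inf_le_left, inf_le_right]

theorem toSubmodule_sInf (T : Set 𝒜.IntersectionLattice) :
    (sInf T).toSubmodule = sInf (toSubmodule '' T) := rfl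

theorem toSubmodule_top : (⊤ : 𝒜.IntersectionLattice).toSubmodule = ⊤ := by
  let M : 𝒜.IntersectionLattice := ⟨⊤, ∅, Set.empty_subset _, by simp⟩
  have h : M ≤ ⊤ := le_top
  exact top_le_iff.1 h

variable (𝒜) in
theorem finite_intersectionLattice : Finite 𝒜.IntersectionLattice := by
  have := 𝒜.finite_ground.powerset.to_subtype
  refine Finite.of_surjective
    (fun S : 𝒜.ground.powerset => (⟨sInf S.1, S.1, S.2, rfl⟩ : 𝒜.IntersectionLattice)) ?_
  rintro ⟨_, S, hS, rfl⟩
  exact ⟨⟨S, hS⟩, rfl⟩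

theorem inf_HRe_covBy {N : Submodule ℝ (Fin d → ℂ)} {i : Fin n} (h : ¬ N ≤ 𝒜.HRe i) :
    N ⊓ 𝒜.HRe i ⋖ N :=
  inf_ker_covBy h

theorem inf_H_covBy {N : Submodule ℝ (Fin d → ℂ)} {i : Fin n} (hRe : N ≤ 𝒜.HRe i)
    (h : ¬ N ≤ 𝒜.H i) : N ⊓ 𝒜.H i ⋖ N := by
  rw [HRe_eq_ker] at hRe
  rw [H_eq_inf_ker, ← inf_assoc, inf_eq_left.2 hRe]
  refine inf_ker_covBy fun hN => h ?_
  rw [H_eq_inf_ker]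
  exact le_inf hRe hN

/-- The intersection lattice is graded by dimension: its covering relation is that of the lattice
of all subspaces. Cutting with `H_i` drops the dimension by two only if cutting with `H_i^ℜ`
drops it by one, so whenever `M < N`, some element above `M` has codimension one in `N`. -/
theorem covBy_iff_toSubmodule {M N : 𝒜.IntersectionLattice} :
    M ⋖ N ↔ M.toSubmodule ⋖ N.toSubmodule := by
  refine ⟨fun h => ?_, fun h => ⟨h.1, fun C hMC hCN => h.2 hMC hCN⟩⟩
  obtain ⟨S, hS, hMS⟩ := exists_toSubmodule_eq_sInf M
  have hNM : ¬ N.toSubmodule ≤ sInf S := fun hN => h.1.not_ge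
    (hMS ▸ hN : N.toSubmodule ≤ M.toSubmodule)
  rw [le_sInf_iff] at hNM
  push Not at hNM
  obtain ⟨e, heS, hNe⟩ := hNM
  have hMe : M.toSubmodule ≤ e := hMS ▸ sInf_le heS
  have key (f : 𝒜.ground) (hMf : M.toSubmodule ≤ f.1)
      (hf : N.toSubmodule ⊓ f.1 ⋖ N.toSubmodule) : M.toSubmodule ⋖ N.toSubmodule := by
    have hle : M ≤ N ⊓ 𝒜.toLattice f := le_inf h.1.le hMf
    have hco : (N ⊓ 𝒜.toLattice f).toSubmodule = N.toSubmodule ⊓ f.1 := toSubmodule_inf _ _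
    have hlt : N ⊓ 𝒜.toLattice f < N := by
      change (N ⊓ 𝒜.toLattice f).toSubmodule < N.toSubmodule
      rw [hco]
      exact hf.1
    rcases hle.eq_or_lt with he | hl
    · rw [he, hco]
      exact hf
    · exact (h.2 hl hlt).elim
  obtain ⟨i, rfl⟩ | ⟨i, rfl⟩ := hS heS
  · by_cases hi : N.toSubmodule ≤ 𝒜.HRe i
    · exact key (𝒜.groundH i) hMe (inf_H_covBy hi hNe)
    · exact key (𝒜.groundHRe i) (hMe.trans (𝒜.H_le_HRe i)) (inf_HRe_covBy hi)
  · exact key (𝒜.groundHRe i) hMe (inf_HRe_covBy hNe)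

/-- Two distinct hyperplanes of a subspace meet in a hyperplane of each. -/
theorem isWeakLowerModularLattice_intersectionLattice :
    IsWeakLowerModularLattice 𝒜.IntersectionLattice where
  inf_covBy_of_covBy_covBy_sup {a b} ha hb := by
    have hne : a.toSubmodule ≠ b.toSubmodule := fun h => by
      have hab : a = b := toSubmodule_injective h
      rw [hab, sup_idem] at ha
      exact ha.1.false
    rw [covBy_iff_toSubmodule] at ha hb ⊢
    rw [toSubmodule_inf]
    have hsup : a.toSubmodule ⊔ b.toSubmodule = (a ⊔ b).toSubmodule := by
      rcases ha.eq_or_eq le_sup_left (sup_le ha.le hb.le) with h | h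
      · rcases hb.eq_or_eq (sup_eq_left.1 h) ha.le with h' | h'
        · exact (hne h').elim
        · exact (ha.1.ne h').elim
      · exact h
    rw [← hsup] at hb
    exact inf_covBy_of_covBy_sup_right hb

variable (𝒜) in
theorem ker_form_le_ker_form {i j : Fin n}
    (h : LinearMap.ker (𝒜.form i) ≤ LinearMap.ker (𝒜.form j)) : i = j := by
  apply 𝒜.ker_injective
  have hi := LinearMap.isCoatom_ker_of_surjective (LinearMap.surjective (𝒜.form_ne_zero i))
  have hj := LinearMap.isCoatom_ker_of_surjective (LinearMap.surjective (𝒜.form_ne_zero j))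
  exact (hi.le_iff_eq hj.1).1 h |>.symm

theorem eq_of_H_le_HRe {i j : Fin n} (h : 𝒜.H i ≤ 𝒜.HRe j) : i = j := by
  refine 𝒜.ker_form_le_ker_form fun x hx => ?_
  have : (fun k => (x k : ℂ) * Complex.I) ∈ 𝒜.H i := by
    have h0 : 𝒜.form i (fun _ => 0) = 0 := map_zero _
    rw [mem_H, reForm_apply, imForm_apply]
    simpa [h0] using hx
  exact (𝒜.imag_mem_HRe_iff j x).1 (h this)

theorem HRe_isCoatom (i : Fin n) : IsCoatom (𝒜.HRe i) := by
  rw [HRe_eq_ker]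
  refine LinearMap.isCoatom_ker_of_surjective (LinearMap.surjective fun h => ?_)
  refine 𝒜.form_ne_zero i (LinearMap.ext fun x => ?_)
  refine (𝒜.imag_mem_HRe_iff i x).1 ?_
  rw [HRe_eq_ker, h]
  simp

/-- The intersections above `H_i` other than `H_i` itself all contain `H_i^ℜ`. -/
theorem eq_H_or_HRe_le {i : Fin n} {M : 𝒜.IntersectionLattice} (h : 𝒜.H i ≤ M.toSubmodule) :
    M.toSubmodule = 𝒜.H i ∨ 𝒜.HRe i ≤ M.toSubmodule := by
  obtain ⟨S, hS, hMS⟩ := exists_toSubmodule_eq_sInf M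
  rw [or_iff_not_imp_left]
  intro hne
  rw [hMS]
  refine le_sInf fun e he => ?_
  have hMe : M.toSubmodule ≤ e := hMS ▸ sInf_le he
  obtain ⟨j, rfl⟩ | ⟨j, rfl⟩ := hS he
  · obtain rfl := eq_of_H_le_HRe ((h.trans hMe).trans (𝒜.H_le_HRe j))
    exact (hne (hMe.antisymm h)).elim
  · obtain rfl := eq_of_H_le_HRe (h.trans hMe)
    exact le_rfl

theorem H_lt_HRe (i : Fin n) : 𝒜.H i < 𝒜.HRe i :=
  lt_of_le_of_ne (𝒜.H_le_HRe i) (𝒜.H_ne_HRe i i)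

theorem infIrred_toLattice (e : 𝒜.ground) : InfIrred (𝒜.toLattice e) := by
  revert e
  rw [forall_ground]
  refine ⟨fun i => ⟨fun hmax => ?_, fun b c hbc => ?_⟩,
    fun i => ⟨fun hmax => ?_, fun b c hbc => ?_⟩⟩
  · exact (H_lt_HRe i).not_ge (hmax (b := 𝒜.toLattice (𝒜.groundHRe i)) (𝒜.H_le_HRe i))
  · have hb : 𝒜.H i ≤ b.toSubmodule := (hbc ▸ inf_le_left : 𝒜.toLattice (𝒜.groundH i) ≤ b)
    have hc : 𝒜.H i ≤ c.toSubmodule := (hbc ▸ inf_le_right : 𝒜.toLattice (𝒜.groundH i) ≤ c)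
    rcases eq_H_or_HRe_le hb with h | h
    · exact Or.inl (toSubmodule_injective h)
    rcases eq_H_or_HRe_le hc with h' | h'
    · exact Or.inr (toSubmodule_injective h')
    have := congrArg toSubmodule hbc
    rw [toSubmodule_inf] at this
    exact ((H_lt_HRe i).not_ge ((le_inf h h').trans this.le)).elim
  · exact (HRe_isCoatom i).1 (top_le_iff.1 (toSubmodule_top.ge.trans (hmax (b := ⊤) le_top)))
  · have hb : 𝒜.HRe i ≤ b.toSubmodule := (hbc ▸ inf_le_left : 𝒜.toLattice (𝒜.groundHRe i) ≤ b)
    have hc : 𝒜.HRe i ≤ c.toSubmodule := (hbc ▸ inf_le_right : 𝒜.toLattice (𝒜.groundHRe i) ≤ c)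
    rcases (HRe_isCoatom i).le_iff.1 hb with h | h
    · rcases (HRe_isCoatom i).le_iff.1 hc with h' | h'
      · have := congrArg toSubmodule hbc
        rw [toSubmodule_inf, h, h', inf_idem] at this
        exact ((HRe_isCoatom i).1 this.symm).elim
      · exact Or.inr (toSubmodule_injective h')
    · exact Or.inl (toSubmodule_injective h)

variable (𝒜) in
theorem setOf_infIrred_eq_range_toLattice :
    {M : 𝒜.IntersectionLattice | InfIrred M} = Set.range 𝒜.toLattice := by
  refine Set.Subset.antisymm (fun M hM => ?_) ?_
  · obtain ⟨S, hS, hMS⟩ := exists_toSubmodule_eq_sInf M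
    have hfin : {e : 𝒜.ground | e.1 ∈ S}.Finite := Set.toFinite _
    have hinf : hfin.toFinset.inf 𝒜.toLattice = M := by
      rw [Finset.inf_eq_sInf_image]
      apply toSubmodule_injective
      rw [toSubmodule_sInf, hMS]
      congr 1
      ext e
      constructor
      · rintro ⟨_, ⟨f, hf, rfl⟩, rfl⟩
        exact hfin.mem_toFinset.1 hf
      · intro he
        exact ⟨𝒜.toLattice ⟨e, hS he⟩, ⟨⟨e, hS he⟩, hfin.mem_toFinset.2 he, rfl⟩, rfl⟩
    obtain ⟨e, -, he⟩ := InfIrred.finset_inf_eq hM hinf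
    exact ⟨e, he⟩
  · rintro _ ⟨e, rfl⟩
    exact infIrred_toLattice e

end RealArrangement

/-! ### Feasible sets as pairs of independent sets -/

namespace RealArrangement

open IntersectionLattice

variable {d n : ℕ} {𝒜 : RealArrangement d n}

/-- The indices `i` with `H_i ∈ X`. -/
def indexH (X : Set 𝒜.ground) : Set (Fin n) := {i | 𝒜.groundH i ∈ X}

/-- The indices `i` with `H_i^ℜ ∈ X`. -/
def indexHRe (X : Set 𝒜.ground) : Set (Fin n) := {i | 𝒜.groundHRe i ∈ X}

variable (𝒜) in
/-- The set of the `H_i` with `i ∈ I` and the `H_j^ℜ` with `j ∈ J`. -/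
def ofIndex (I J : Set (Fin n)) : Set 𝒜.ground := 𝒜.groundH '' I ∪ 𝒜.groundHRe '' J

@[simp] theorem mem_indexH {X : Set 𝒜.ground} {i : Fin n} : i ∈ indexH X ↔ 𝒜.groundH i ∈ X :=
  Iff.rfl

@[simp] theorem mem_indexHRe {X : Set 𝒜.ground} {i : Fin n} :
    i ∈ indexHRe X ↔ 𝒜.groundHRe i ∈ X := Iff.rfl

@[simp] theorem indexH_ofIndex (I J : Set (Fin n)) : indexH (𝒜.ofIndex I J) = I := by
  ext i
  simp [ofIndex, groundH_inj, groundHRe_ne_groundH]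

@[simp] theorem indexHRe_ofIndex (I J : Set (Fin n)) : indexHRe (𝒜.ofIndex I J) = J := by
  ext i
  simp [ofIndex, groundHRe_inj, groundH_ne_groundHRe]

theorem subset_iff_index {X Y : Set 𝒜.ground} :
    X ⊆ Y ↔ indexH X ⊆ indexH Y ∧ indexHRe X ⊆ indexHRe Y :=
  𝒜.forall_ground

theorem disjoint_iff_index {X Y : Set 𝒜.ground} :
    Disjoint X Y ↔ Disjoint (indexH X) (indexH Y) ∧ Disjoint (indexHRe X) (indexHRe Y) := by
  simp only [Set.disjoint_left]
  exact 𝒜.forall_ground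

theorem indexH_union (X Y : Set 𝒜.ground) : indexH (X ∪ Y) = indexH X ∪ indexH Y := rfl

@[simp] theorem indexH_insert_groundH (i : Fin n) (X : Set 𝒜.ground) :
    indexH (insert (𝒜.groundH i) X) = insert i (indexH X) := by
  ext j
  simp [groundH_inj]

@[simp] theorem indexHRe_insert_groundH (i : Fin n) (X : Set 𝒜.ground) :
    indexHRe (insert (𝒜.groundH i) X) = indexHRe X := by
  ext j
  simp [groundHRe_ne_groundH]

@[simp] theorem indexH_insert_groundHRe (i : Fin n) (X : Set 𝒜.ground) :
    indexH (insert (𝒜.groundHRe i) X) = indexH X := by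
  ext j
  simp [groundH_ne_groundHRe]

@[simp] theorem indexHRe_insert_groundHRe (i : Fin n) (X : Set 𝒜.ground) :
    indexHRe (insert (𝒜.groundHRe i) X) = insert i (indexHRe X) := by
  ext j
  simp [groundHRe_inj]

theorem ofIndex_index (X : Set 𝒜.ground) : 𝒜.ofIndex (indexH X) (indexHRe X) = X := by
  apply Set.Subset.antisymm <;> rw [subset_iff_index] <;> simp

theorem ncard_eq_add (X : Set 𝒜.ground) :
    X.ncard = (indexH X).ncard + (indexHRe X).ncard := by
  conv_lhs => rw [← ofIndex_index X, ofIndex]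
  rw [Set.ncard_union_eq, Set.ncard_image_of_injective, Set.ncard_image_of_injective]
  · exact fun _ _ h => 𝒜.groundHRe_inj.1 h
  · exact fun _ _ h => 𝒜.groundH_inj.1 h
  · rw [Set.disjoint_left]
    rintro _ ⟨i, -, rfl⟩ ⟨j, -, h⟩
    exact 𝒜.groundHRe_ne_groundH j i h

/-- The closure of the indices `i` with `H_i ∈ X`. -/
def closureH (X : Set 𝒜.ground) : Set (Fin n) := spanClosure ℝ 𝒜.form (indexH X)

/-- The closure of the indices `i` with `H_i^ℜ ∈ X`. -/
def closureHRe (X : Set 𝒜.ground) : Set (Fin n) := spanClosure ℝ 𝒜.form (indexHRe X)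

/-- Both index sets of `X` are independent, and the closure of the second contains the first. By
`mem_feasible_iff`, this is the same as feasibility. -/
structure IsIndepPair (X : Set 𝒜.ground) : Prop where
  indepH : LinearIndepOn ℝ 𝒜.form (indexH X)
  indepHRe : LinearIndepOn ℝ 𝒜.form (indexHRe X)
  subset_closure : indexH X ⊆ closureHRe X

theorem isIndepPair_empty : IsIndepPair (∅ : Set 𝒜.ground) where
  indepH := linearIndepOn_empty ℝ 𝒜.form
  indepHRe := linearIndepOn_empty ℝ 𝒜.form
  subset_closure _ h := h.elim

namespace IsIndepPair

variable {X : Set 𝒜.ground}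

theorem closureH_subset_closureHRe (hX : IsIndepPair X) : closureH X ⊆ closureHRe X :=
  spanClosure_subset_iff.2 hX.subset_closure

theorem insert_groundH_iff (hX : IsIndepPair X) {i : Fin n} :
    (𝒜.groundH i ∉ X ∧ IsIndepPair (insert (𝒜.groundH i) X)) ↔
      i ∈ closureHRe X ∧ i ∉ closureH X := by
  constructor
  · rintro ⟨hi, h⟩
    have h1 := h.indepH
    have h2 := h.subset_closure
    replace hi : i ∉ indexH X := hi
    rw [indexH_insert_groundH] at h1 h2
    rw [closureHRe, indexHRe_insert_groundH] at h2
    exact ⟨h2 (Set.mem_insert i _), ((linearIndepOn_insert hi).1 h1).2⟩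
  · rintro ⟨h1, h2⟩
    have hi : i ∉ indexH X := fun hi => h2 (subset_spanClosure _ _ hi)
    refine ⟨hi, ?_, ?_, ?_⟩
    · rw [indexH_insert_groundH]
      exact (linearIndepOn_insert hi).2 ⟨hX.indepH, h2⟩
    · rw [indexHRe_insert_groundH]
      exact hX.indepHRe
    · rw [closureHRe, indexH_insert_groundH, indexHRe_insert_groundH]
      exact Set.insert_subset h1 hX.subset_closure

theorem insert_groundHRe_iff (hX : IsIndepPair X) {i : Fin n} :
    (𝒜.groundHRe i ∉ X ∧ IsIndepPair (insert (𝒜.groundHRe i) X)) ↔ i ∉ closureHRe X := by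
  constructor
  · rintro ⟨hi, h⟩
    have h1 := h.indepHRe
    replace hi : i ∉ indexHRe X := hi
    rw [indexHRe_insert_groundHRe] at h1
    exact ((linearIndepOn_insert hi).1 h1).2
  · intro h
    have hi : i ∉ indexHRe X := fun hi => h (subset_spanClosure _ _ hi)
    refine ⟨hi, ?_, ?_, ?_⟩
    · rw [indexH_insert_groundHRe]
      exact hX.indepH
    · rw [indexHRe_insert_groundHRe]
      exact (linearIndepOn_insert hi).2 ⟨hX.indepHRe, h⟩
    · rw [closureHRe, indexH_insert_groundHRe, indexHRe_insert_groundHRe]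
      exact hX.subset_closure.trans (spanClosure_mono _ (Set.subset_insert i _))

/-- The `H_i` may be removed in any order, and the `H_j^ℜ` once no `H_i` is left. -/
theorem exists_sdiff_singleton (hX : IsIndepPair X) (hne : X ≠ ∅) :
    ∃ e ∈ X, IsIndepPair (X \ {e}) := by
  by_cases hI : ∃ i, 𝒜.groundH i ∈ X
  · obtain ⟨i, hi⟩ := hI
    have hRe : indexHRe (X \ {𝒜.groundH i}) = indexHRe X := by
      ext j
      simp [groundHRe_ne_groundH]
    refine ⟨_, hi, hX.indepH.mono fun j hj => hj.1, hX.indepHRe.mono fun j hj => hj.1, ?_⟩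
    rw [closureHRe, hRe]
    exact fun j hj => hX.subset_closure hj.1
  · push Not at hI
    obtain ⟨e, he⟩ := Set.nonempty_iff_ne_empty.2 hne
    exact ⟨e, he, hX.indepH.mono fun j hj => hj.1, hX.indepHRe.mono fun j hj => hj.1,
      fun j hj => (hI j hj.1).elim⟩

end IsIndepPair

/-- The intersection of the members of `X`. -/
noncomputable def meet (X : Set 𝒜.ground) : 𝒜.IntersectionLattice := sInf (𝒜.toLattice '' X)

theorem mem_meet {X : Set 𝒜.ground} {z : Fin d → ℂ} :
    z ∈ (meet X).toSubmodule ↔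
      (∀ i, 𝒜.groundH i ∈ X → z ∈ 𝒜.H i) ∧ ∀ i, 𝒜.groundHRe i ∈ X → z ∈ 𝒜.HRe i := by
  have h : z ∈ (meet X).toSubmodule ↔ ∀ e ∈ X, z ∈ e.1 := by
    rw [meet, toSubmodule_sInf, Submodule.mem_sInf]
    constructor
    · exact fun h e he => h _ ⟨_, ⟨e, he, rfl⟩, rfl⟩
    · rintro h _ ⟨_, ⟨e, he, rfl⟩, rfl⟩
      exact h e he
  rw [h]
  exact 𝒜.forall_ground

theorem meet_insert (e : 𝒜.ground) (X : Set 𝒜.ground) :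
    meet (insert e X) = meet X ⊓ 𝒜.toLattice e := by
  rw [meet, meet, Set.image_insert_eq, sInf_insert, inf_comm]

theorem toSubmodule_meet_insert (e : 𝒜.ground) (X : Set 𝒜.ground) :
    (meet (insert e X)).toSubmodule = (meet X).toSubmodule ⊓ e.1 := by
  rw [meet_insert, toSubmodule_inf]
  rfl

/-- The point `x + iy` of `ℂ^d`. -/
def mkPoint (x y : Fin d → ℝ) : Fin d → ℂ := fun j => ⟨x j, y j⟩

@[simp] theorem reForm_mkPoint (i : Fin n) (x y : Fin d → ℝ) :
    𝒜.reForm i (mkPoint x y) = 𝒜.form i x :=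
  𝒜.reForm_apply i _

@[simp] theorem imForm_mkPoint (i : Fin n) (x y : Fin d → ℝ) :
    𝒜.imForm i (mkPoint x y) = 𝒜.form i y :=
  𝒜.imForm_apply i _

/-- The indices of the hyperplanes `H_i` that contain `z`. -/
def zerosH (𝒜 : RealArrangement d n) (z : Fin d → ℂ) : Set (Fin n) := {i | z ∈ 𝒜.H i}

/-- The indices of the hypersurfaces `H_i^ℜ` that contain `z`. -/
def zerosHRe (𝒜 : RealArrangement d n) (z : Fin d → ℂ) : Set (Fin n) := {i | z ∈ 𝒜.HRe i}

theorem zerosH_subset_zerosHRe (z : Fin d → ℂ) : 𝒜.zerosH z ⊆ 𝒜.zerosHRe z :=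
  fun i hz => 𝒜.H_le_HRe i hz

theorem spanClosure_zerosHRe (z : Fin d → ℂ) :
    spanClosure ℝ 𝒜.form (𝒜.zerosHRe z) = 𝒜.zerosHRe z := by
  simp only [zerosHRe, mem_HRe, imForm_apply]
  exact spanClosure_setOf_apply_eq_zero _ _

theorem spanClosure_zerosH (z : Fin d → ℂ) :
    spanClosure ℝ 𝒜.form (𝒜.zerosH z) = 𝒜.zerosH z := by
  refine Set.Subset.antisymm (fun i hi => ?_) (subset_spanClosure _ _)
  refine 𝒜.mem_H.2 ⟨?_, ?_⟩
  · have h : 𝒜.zerosH z ⊆ {i | 𝒜.form i (fun j => (z j).im) = 0} := fun j hj => by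
      simpa only [imForm_apply, Set.mem_ofPred_eq] using (𝒜.mem_H.1 hj).1
    have := spanClosure_mono (K := ℝ) 𝒜.form h hi
    rw [spanClosure_setOf_apply_eq_zero] at this
    rwa [imForm_apply]
  · have h : 𝒜.zerosH z ⊆ {i | 𝒜.form i (fun j => (z j).re) = 0} := fun j hj => by
      simpa only [reForm_apply, Set.mem_ofPred_eq] using (𝒜.mem_H.1 hj).2
    have := spanClosure_mono (K := ℝ) 𝒜.form h hi
    rw [spanClosure_setOf_apply_eq_zero] at this
    rwa [reForm_apply]

theorem meet_le_HRe {X : Set 𝒜.ground} {i : Fin n} (hi : i ∈ closureHRe X) :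
    (meet X).toSubmodule ≤ 𝒜.HRe i := by
  intro z hz
  have h : indexHRe X ⊆ 𝒜.zerosHRe z := fun j hj => (mem_meet.1 hz).2 j hj
  have := spanClosure_mono (K := ℝ) 𝒜.form h hi
  rwa [spanClosure_zerosHRe] at this

theorem meet_le_H {X : Set 𝒜.ground} {i : Fin n} (hi : i ∈ closureH X) :
    (meet X).toSubmodule ≤ 𝒜.H i := by
  intro z hz
  have h : indexH X ⊆ 𝒜.zerosH z := fun j hj => (mem_meet.1 hz).1 j hj
  have := spanClosure_mono (K := ℝ) 𝒜.form h hi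
  rwa [spanClosure_zerosH] at this

/-- The witness is the real point given by a common zero of the forms with index in `indexH X`. -/
theorem exists_real_mem_meet_notMem_H {X : Set 𝒜.ground} {i : Fin n} (hi : i ∉ closureH X) :
    ∃ z ∈ (meet X).toSubmodule, (∀ j, z ∈ 𝒜.HRe j) ∧ z ∉ 𝒜.H i := by
  obtain ⟨y, hy, hyi⟩ := exists_apply_ne_zero_of_notMem_spanClosure hi
  refine ⟨mkPoint y 0, mem_meet.2 ⟨fun j hj => ?_, fun j _ => ?_⟩, fun j => ?_, fun h => ?_⟩
  · simpa [mem_H] using hy j hj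
  · simp [mem_HRe]
  · simp [mem_HRe]
  · exact hyi (by simpa [mem_H] using h)

/-- The witness is the purely imaginary point given by a common zero of the forms with index in
`indexHRe X`. -/
theorem IsIndepPair.exists_mem_meet_notMem_HRe {X : Set 𝒜.ground} (hX : IsIndepPair X) {i : Fin n}
    (hi : i ∉ closureHRe X) : ∃ z ∈ (meet X).toSubmodule, z ∉ 𝒜.HRe i := by
  obtain ⟨y, hy, hyi⟩ := exists_apply_ne_zero_of_notMem_spanClosure hi
  have hcl : closureHRe X ⊆ {j | 𝒜.form j y = 0} := by
    rw [← spanClosure_setOf_apply_eq_zero]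
    exact spanClosure_mono _ hy
  refine ⟨mkPoint 0 y, mem_meet.2 ⟨fun j hj => ?_, fun j hj => ?_⟩, fun h => ?_⟩
  · simpa [mem_H] using hcl (hX.subset_closure hj)
  · simpa [mem_HRe] using hy j hj
  · exact hyi (by simpa [mem_HRe] using h)

theorem IsIndepPair.meet_insert_covBy_iff {X : Set 𝒜.ground} (hX : IsIndepPair X)
    (e : 𝒜.ground) : meet (insert e X) ⋖ meet X ↔ e ∉ X ∧ IsIndepPair (insert e X) := by
  rw [covBy_iff_toSubmodule, toSubmodule_meet_insert]
  revert e
  rw [forall_ground]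
  refine ⟨fun i => ?_, fun i => ?_⟩
  · rw [hX.insert_groundH_iff]
    change _ ⊓ 𝒜.H i ⋖ _ ↔ _
    constructor
    · intro h
      have hi : i ∉ closureH X := fun hi => h.1.ne (inf_eq_left.2 (meet_le_H hi))
      refine ⟨by_contra fun hRe => ?_, hi⟩
      -- otherwise the intersection with `H_i^ℜ` lies strictly in between
      obtain ⟨z, hz, hzi⟩ := hX.exists_mem_meet_notMem_HRe hRe
      obtain ⟨w, hw, hwRe, hwi⟩ := exists_real_mem_meet_notMem_H hi
      refine h.2 (c := (meet X).toSubmodule ⊓ 𝒜.HRe i) ?_ ?_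
      · refine lt_of_le_of_ne (inf_le_inf_left _ (𝒜.H_le_HRe i)) fun he => hwi ?_
        exact (he.ge ⟨hw, hwRe i⟩ : w ∈ (meet X).toSubmodule ⊓ 𝒜.H i).2
      · exact lt_of_le_of_ne inf_le_left fun he => hzi (inf_eq_left.1 he hz)
    · rintro ⟨hRe, hi⟩
      obtain ⟨w, hw, -, hwi⟩ := exists_real_mem_meet_notMem_H hi
      exact inf_H_covBy (meet_le_HRe hRe) fun h => hwi (h hw)
  · rw [hX.insert_groundHRe_iff]
    change _ ⊓ 𝒜.HRe i ⋖ _ ↔ _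
    constructor
    · exact fun h hi => h.1.ne (inf_eq_left.2 (meet_le_HRe hi))
    · intro hi
      obtain ⟨z, hz, hzi⟩ := hX.exists_mem_meet_notMem_HRe hi
      exact inf_HRe_covBy fun h => hzi (h hz)

theorem mem_feasible_iff_meet {X : Set 𝒜.ground} :
    X ∈ 𝒜.feasible ↔ ∃ (k : ℕ) (h : Fin k → 𝒜.ground), X = Set.range h ∧
      ∀ j, meet (h '' Set.Iic j) ⋖ meet (h '' Set.Iio j) := by
  simp only [meet, Set.image_image, sInf_image, Set.mem_Iic, Set.mem_Iio]
  rfl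

theorem empty_mem_feasible : ∅ ∈ 𝒜.feasible :=
  mem_feasible_iff_meet.2 ⟨0, Fin.elim0, by simp, fun j => j.elim0⟩

theorem insert_mem_feasible {X : Set 𝒜.ground} {e : 𝒜.ground} (hX : X ∈ 𝒜.feasible)
    (he : meet (insert e X) ⋖ meet X) : insert e X ∈ 𝒜.feasible := by
  obtain ⟨k, h, rfl, hcov⟩ := mem_feasible_iff_meet.1 hX
  refine mem_feasible_iff_meet.2 ⟨k + 1, Fin.snoc h e, (Fin.range_snoc h e).symm, fun j => ?_⟩
  have hcast (T : Set (Fin k)) :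
      (Fin.snoc h e : Fin (k + 1) → 𝒜.ground) '' (Fin.castSucc '' T) = h '' T := by
    rw [Set.image_image]
    simp
  induction j using Fin.lastCases with
  | last =>
    have h1 : Set.Iio (Fin.last k) = Fin.castSucc '' Set.univ := by
      ext i
      simp only [Set.mem_Iio, Set.image_univ, Set.mem_range, Fin.exists_castSucc_eq,
        Fin.lt_last_iff_ne_last]
    rw [← Set.Iio_insert, Set.image_insert_eq, h1, hcast, Fin.snoc_last, Set.image_univ]
    exact he
  | cast j =>
    have h1 : Set.Iio j.castSucc = Fin.castSucc '' Set.Iio j := by simp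
    have h2 : Set.Iic j.castSucc = Fin.castSucc '' Set.Iic j := by simp
    rw [h1, h2, hcast, hcast]
    exact hcov j

theorem mem_feasible_iff {X : Set 𝒜.ground} : X ∈ 𝒜.feasible ↔ IsIndepPair X := by
  constructor
  · intro hX
    obtain ⟨k, h, rfl, hcov⟩ := mem_feasible_iff_meet.1 hX
    have key (m : ℕ) (hm : m ≤ k) : IsIndepPair (h '' {i | i.1 < m}) := by
      induction m with
      | zero => simpa using isIndepPair_empty
      | succ m ih =>
        have hj := hcov ⟨m, hm⟩
        rw [← Set.Iio_insert, Set.image_insert_eq] at hj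
        have hset : ({i | i.1 < m + 1} : Set (Fin k)) = insert ⟨m, hm⟩ {i | i.1 < m} := by
          ext i
          simp only [Set.mem_ofPred_eq, Set.mem_insert_iff, Fin.ext_iff]
          omega
        rw [hset, Set.image_insert_eq]
        exact (((ih (by omega)).meet_insert_covBy_iff _).1 hj).2
    have := key k le_rfl
    simpa using this
  · induction hN : X.ncard generalizing X with
    | zero =>
      intro _
      rw [Set.ncard_eq_zero] at hN
      exact hN ▸ empty_mem_feasible
    | succ N ih =>
      intro hX
      have hne : X ≠ ∅ := by
        rintro rfl
        simp at hN
      obtain ⟨e, he, hXe⟩ := hX.exists_sdiff_singleton hne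
      have hins : insert e (X \ {e}) = X := Set.insert_sdiff_self_of_mem he
      rw [← hins]
      refine insert_mem_feasible (ih ?_ hXe) ((hXe.meet_insert_covBy_iff e).2 ⟨by simp, ?_⟩)
      · rw [Set.ncard_sdiff_singleton_of_mem he, hN, Nat.add_sub_cancel]
      · rwa [hins]

/-! ### The interval greedoid -/

theorem IsIndepPair.exists_insert {X Y : Set 𝒜.ground} (hX : IsIndepPair X) (hY : IsIndepPair Y)
    (hcard : Y.ncard < X.ncard) : ∃ e ∈ X \ Y, IsIndepPair (insert e Y) := by
  by_cases hRe : indexHRe X ⊆ closureHRe Y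
  · have h1 := hX.indepHRe.ncard_le_ncard hY.indepHRe hRe
    have hH : ¬ indexH X ⊆ closureH Y := fun hH => by
      have h2 := hX.indepH.ncard_le_ncard hY.indepH hH
      rw [ncard_eq_add, ncard_eq_add] at hcard
      omega
    obtain ⟨i, hi, hiY⟩ := Set.not_subset.1 hH
    obtain ⟨h3, h4⟩ := hY.insert_groundH_iff.2
      ⟨spanClosure_subset_iff.2 hRe (hX.subset_closure hi), hiY⟩
    exact ⟨_, ⟨hi, h3⟩, h4⟩
  · obtain ⟨i, hi, hiY⟩ := Set.not_subset.1 hRe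
    obtain ⟨h3, h4⟩ := hY.insert_groundHRe_iff.2 hiY
    exact ⟨_, ⟨hi, h3⟩, h4⟩

theorem closureH_mono {X Y : Set 𝒜.ground} (h : X ⊆ Y) : closureH X ⊆ closureH Y :=
  spanClosure_mono _ (subset_iff_index.1 h).1

theorem closureHRe_mono {X Y : Set 𝒜.ground} (h : X ⊆ Y) : closureHRe X ⊆ closureHRe Y :=
  spanClosure_mono _ (subset_iff_index.1 h).2

open IntervalGreedoid

variable (𝒜) in
theorem isIntervalGreedoid_feasible : IsIntervalGreedoid 𝒜.feasible where
  finite_ground := inferInstance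
  nonempty := ⟨∅, empty_mem_feasible⟩
  accessible X hX hne := by
    simp only [mem_feasible_iff] at hX ⊢
    exact hX.exists_sdiff_singleton hne
  exchange X hX Y hY hcard := by
    simp only [mem_feasible_iff] at hX hY ⊢
    exact hX.exists_insert hY hcard
  interval X hX Y hY Z hZ hXY hYZ := by
    simp only [mem_feasible_iff] at hX hY hZ ⊢
    rw [forall_ground]
    refine ⟨fun i hi hXi hZi => ?_, fun i hi hXi hZi => ?_⟩
    · have h1 := hX.insert_groundH_iff.1 ⟨fun he => hi (hYZ (hXY he)), hXi⟩
      have h2 := hZ.insert_groundH_iff.1 ⟨hi, hZi⟩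
      exact (hY.insert_groundH_iff.2
        ⟨closureHRe_mono hXY h1.1, fun h => h2.2 (closureH_mono hYZ h)⟩).2
    · have h2 := hZ.insert_groundHRe_iff.1 ⟨hi, hZi⟩
      exact (hY.insert_groundHRe_iff.2 fun h => h2 (closureHRe_mono hYZ h)).2

end RealArrangement

/-! ### Flats -/

namespace RealArrangement

open IntervalGreedoid

variable {d n : ℕ} {𝒜 : RealArrangement d n}

theorem IsIndepPair.mem_contraction_of_closure_eq {X Y Z : Set 𝒜.ground} (hY : IsIndepPair Y)
    (hH : closureH X = closureH Y) (hRe : closureHRe X = closureHRe Y)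
    (hZ : Z ∈ contraction 𝒜.feasible X) : Z ∈ contraction 𝒜.feasible Y := by
  obtain ⟨hd, hf⟩ := hZ
  rw [disjoint_iff_index] at hd
  rw [mem_feasible_iff] at hf
  obtain ⟨h1, h2⟩ := hY.indepH.union_of_spanClosure_eq hH hd.1 hf.indepH
  obtain ⟨h3, h4⟩ := hY.indepHRe.union_of_spanClosure_eq hRe hd.2 hf.indepHRe
  have hcl : closureHRe (X ∪ Z) = closureHRe (Y ∪ Z) := spanClosure_union_congr _ hRe
  refine ⟨disjoint_iff_index.2 ⟨h1, h3⟩, mem_feasible_iff.2 ⟨h2, h4, ?_⟩⟩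
  rw [indexH_union, Set.union_subset_iff, ← hcl]
  refine ⟨?_, Set.subset_union_right.trans hf.subset_closure⟩
  refine hY.subset_closure.trans ?_
  rw [← hRe]
  exact closureHRe_mono Set.subset_union_left

theorem singleton_mem_contraction {F : Set (Set 𝒜.ground)} {X : Set 𝒜.ground} {e : 𝒜.ground} :
    {e} ∈ contraction F X ↔ e ∉ X ∧ insert e X ∈ F := by
  rw [contraction, Set.mem_ofPred_eq, Set.disjoint_singleton_left, Set.union_singleton]

/-- A flat amounts to its pair of closures. In one direction, the closures can be read off from
the one-element sets in the contraction. -/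
theorem IsIndepPair.contraction_eq_iff {X Y : Set 𝒜.ground} (hX : IsIndepPair X)
    (hY : IsIndepPair Y) : contraction 𝒜.feasible X = contraction 𝒜.feasible Y ↔
      closureH X = closureH Y ∧ closureHRe X = closureHRe Y := by
  constructor
  · intro h
    have hs (e : 𝒜.ground) : (e ∉ X ∧ IsIndepPair (insert e X)) ↔
        (e ∉ Y ∧ IsIndepPair (insert e Y)) := by
      rw [← mem_feasible_iff, ← mem_feasible_iff, ← singleton_mem_contraction,
        ← singleton_mem_contraction, h]
    have hRe : closureHRe X = closureHRe Y := by
      ext i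
      have := hs (𝒜.groundHRe i)
      rwa [hX.insert_groundHRe_iff, hY.insert_groundHRe_iff, not_iff_not] at this
    refine ⟨?_, hRe⟩
    ext i
    have := hs (𝒜.groundH i)
    rw [hX.insert_groundH_iff, hY.insert_groundH_iff, hRe] at this
    have h1 := hX.closureH_subset_closureHRe
    rw [hRe] at h1
    have h2 := hY.closureH_subset_closureHRe
    by_cases hi : i ∈ closureHRe Y
    · simpa [hi, not_iff_not] using this
    · exact iff_of_false (fun h => hi (h1 h)) fun h => hi (h2 h)
  · rintro ⟨hH, hRe⟩
    ext Z
    exact ⟨hY.mem_contraction_of_closure_eq hH hRe,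
      hX.mem_contraction_of_closure_eq hH.symm hRe.symm⟩

theorem IsIndepPair.exists_extension {Y : Set 𝒜.ground} (hY : IsIndepPair Y) {I J : Set (Fin n)}
    (hI : indexH Y ⊆ I) (hJ : indexHRe Y ⊆ J) (hIJ : I ⊆ J) :
    ∃ X, IsIndepPair X ∧ Y ⊆ X ∧ closureH X = spanClosure ℝ 𝒜.form I ∧
      closureHRe X = spanClosure ℝ 𝒜.form J := by
  obtain ⟨B, hYB, hBI, hB, hBcl⟩ := hY.indepH.exists_spanClosure_eq hI
  obtain ⟨C, hYC, hCJ, hC, hCcl⟩ := hY.indepHRe.exists_spanClosure_eq hJ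
  refine ⟨𝒜.ofIndex B C, ⟨by simpa, by simpa, ?_⟩, ?_, by simpa [closureH], by simpa [closureHRe]⟩
  · rw [closureHRe, indexH_ofIndex, indexHRe_ofIndex, hCcl]
    exact (hBI.trans hIJ).trans (subset_spanClosure _ _)
  · rw [subset_iff_index]
    simpa using ⟨hYB, hYC⟩

/-- The flat given by the point `z`: the feasible sets whose closures are the two zero sets
of `z`. By `mem_flats_iff`, every flat arises in this way. -/
def flatAt (𝒜 : RealArrangement d n) (z : Fin d → ℂ) : Set (Set 𝒜.ground) :=
  {X | IsIndepPair X ∧ closureH X = 𝒜.zerosH z ∧ closureHRe X = 𝒜.zerosHRe z}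

theorem exists_superset_mem_flatAt {Y : Set 𝒜.ground} (hY : IsIndepPair Y) {z : Fin d → ℂ}
    (hH : indexH Y ⊆ 𝒜.zerosH z) (hRe : indexHRe Y ⊆ 𝒜.zerosHRe z) :
    ∃ X ∈ 𝒜.flatAt z, Y ⊆ X := by
  obtain ⟨X, hX, hYX, h1, h2⟩ := hY.exists_extension hH hRe (zerosH_subset_zerosHRe z)
  rw [spanClosure_zerosH] at h1
  rw [spanClosure_zerosHRe] at h2
  exact ⟨X, ⟨hX, h1, h2⟩, hYX⟩

theorem flatAt_nonempty (z : Fin d → ℂ) : (𝒜.flatAt z).Nonempty := by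
  obtain ⟨X, hX, -⟩ := exists_superset_mem_flatAt (isIndepPair_empty (𝒜 := 𝒜)) (z := z)
    (fun _ h => h.elim) fun _ h => h.elim
  exact ⟨X, hX⟩

theorem flatOf_eq_flatAt {X : Set 𝒜.ground} {z : Fin d → ℂ} (hX : X ∈ 𝒜.flatAt z) :
    flatOf 𝒜.feasible X = 𝒜.flatAt z := by
  obtain ⟨hX, h1, h2⟩ := hX
  ext Y
  simp only [flatOf, flatAt, Set.mem_ofPred_eq, mem_feasible_iff]
  refine and_congr_right fun hY => ?_
  rw [hY.contraction_eq_iff hX, h1, h2]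

/-- The real and the imaginary part of the point are generic common zeros. -/
theorem IsIndepPair.exists_mem_flatAt {X : Set 𝒜.ground} (hX : IsIndepPair X) :
    ∃ z, X ∈ 𝒜.flatAt z := by
  obtain ⟨x, hx⟩ := exists_setOf_apply_eq_zero_eq_spanClosure (K := ℝ) 𝒜.form (indexH X)
  obtain ⟨y, hy⟩ := exists_setOf_apply_eq_zero_eq_spanClosure (K := ℝ) 𝒜.form (indexHRe X)
  have hx' (i : Fin n) : 𝒜.form i x = 0 ↔ i ∈ closureH X := Set.ext_iff.1 hx i
  have hy' (i : Fin n) : 𝒜.form i y = 0 ↔ i ∈ closureHRe X := Set.ext_iff.1 hy i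
  refine ⟨mkPoint x y, hX, ?_, ?_⟩
  · ext i
    simp only [zerosH, Set.mem_ofPred_eq, mem_H, imForm_mkPoint, reForm_mkPoint, hx', hy']
    exact ⟨fun h => ⟨hX.closureH_subset_closureHRe h, h⟩, And.right⟩
  · ext i
    simp only [zerosHRe, Set.mem_ofPred_eq, mem_HRe, imForm_mkPoint, hy']

theorem mem_flats_iff {A : Set (Set 𝒜.ground)} :
    A ∈ flats 𝒜.feasible ↔ ∃ z, A = 𝒜.flatAt z := by
  constructor
  · rintro ⟨X, hX, rfl⟩
    obtain ⟨z, hz⟩ := (mem_feasible_iff.1 hX).exists_mem_flatAt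
    exact ⟨z, flatOf_eq_flatAt hz⟩
  · rintro ⟨z, rfl⟩
    obtain ⟨X, hX⟩ := 𝒜.flatAt_nonempty z
    exact ⟨X, mem_feasible_iff.2 hX.1, (flatOf_eq_flatAt hX).symm⟩

/-- The order of flats is reverse inclusion of zero sets. -/
theorem flatLE_flatAt_iff {z w : Fin d → ℂ} :
    FlatLE 𝒜.feasible (𝒜.flatAt z) (𝒜.flatAt w) ↔
      𝒜.zerosH w ⊆ 𝒜.zerosH z ∧ 𝒜.zerosHRe w ⊆ 𝒜.zerosHRe z := by
  constructor
  · rintro ⟨X, ⟨hX, hX1, hX2⟩, Y, ⟨hY, hY1, hY2⟩, Z, hZ, h⟩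
    obtain ⟨h1, h2⟩ := ((mem_feasible_iff.1 hZ.2).contraction_eq_iff hX).1 h
    rw [← hX1, ← hX2, ← hY1, ← hY2, ← h1, ← h2]
    exact ⟨closureH_mono Set.subset_union_left, closureHRe_mono Set.subset_union_left⟩
  · rintro ⟨hH, hRe⟩
    obtain ⟨Y, hY⟩ := 𝒜.flatAt_nonempty w
    obtain ⟨X, hX, hYX⟩ := exists_superset_mem_flatAt hY.1 (z := z)
      ((subset_spanClosure _ _).trans (hY.2.1.trans_subset hH))
      ((subset_spanClosure _ _).trans (hY.2.2.trans_subset hRe))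
    refine ⟨X, hX, Y, hY, X \ Y, ⟨Set.disjoint_sdiff_left, ?_⟩, ?_⟩
    · rw [Set.union_sdiff_cancel hYX]
      exact mem_feasible_iff.2 hX.1
    · rw [Set.union_sdiff_cancel hYX]

theorem flatAt_congr {z w : Fin d → ℂ} (hH : 𝒜.zerosH z = 𝒜.zerosH w)
    (hRe : 𝒜.zerosHRe z = 𝒜.zerosHRe w) : 𝒜.flatAt z = 𝒜.flatAt w := by
  rw [flatAt, flatAt, hH, hRe]

theorem flatJoin_flatAt {z w u : Fin d → ℂ} (hH : 𝒜.zerosH u = 𝒜.zerosH z ∩ 𝒜.zerosH w)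
    (hRe : 𝒜.zerosHRe u = 𝒜.zerosHRe z ∩ 𝒜.zerosHRe w) :
    flatJoin 𝒜.feasible (𝒜.flatAt z) (𝒜.flatAt w) = 𝒜.flatAt u := by
  have hu : IsFlatJoin 𝒜.feasible (𝒜.flatAt z) (𝒜.flatAt w) (𝒜.flatAt u) := by
    refine ⟨mem_flats_iff.2 ⟨u, rfl⟩, ?_, ?_, fun D hD hz hw => ?_⟩
    · rw [flatLE_flatAt_iff, hH, hRe]
      exact ⟨Set.inter_subset_left, Set.inter_subset_left⟩
    · rw [flatLE_flatAt_iff, hH, hRe]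
      exact ⟨Set.inter_subset_right, Set.inter_subset_right⟩
    · obtain ⟨v, rfl⟩ := mem_flats_iff.1 hD
      rw [flatLE_flatAt_iff] at hz hw ⊢
      rw [hH, hRe]
      exact ⟨Set.subset_inter hz.1 hw.1, Set.subset_inter hz.2 hw.2⟩
  ext Y
  constructor
  · rintro ⟨C, hC, hY⟩
    obtain ⟨v, rfl⟩ := mem_flats_iff.1 hC.1
    have h1 := flatLE_flatAt_iff.1 (hC.2.2.2 _ hu.1 hu.2.1 hu.2.2.1)
    have h2 := flatLE_flatAt_iff.1 (hu.2.2.2 _ hC.1 hC.2.1 hC.2.2.1)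
    rwa [flatAt_congr (h2.1.antisymm h1.1) (h2.2.antisymm h1.2)] at hY
  · exact fun hY => ⟨_, hu, hY⟩

theorem groundH_mem_continuations_flatAt {z : Fin d → ℂ} {i : Fin n} :
    𝒜.groundH i ∈ continuations 𝒜.feasible (𝒜.flatAt z) ↔
      i ∈ 𝒜.zerosHRe z ∧ i ∉ 𝒜.zerosH z := by
  simp only [continuations, Set.mem_ofPred_eq, mem_feasible_iff]
  constructor
  · rintro ⟨X, hX, h⟩
    rwa [hX.1.insert_groundH_iff, hX.2.1, hX.2.2] at h
  · intro h
    obtain ⟨X, hX⟩ := 𝒜.flatAt_nonempty z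
    refine ⟨X, hX, ?_⟩
    rwa [hX.1.insert_groundH_iff, hX.2.1, hX.2.2]

theorem groundHRe_mem_continuations_flatAt {z : Fin d → ℂ} {i : Fin n} :
    𝒜.groundHRe i ∈ continuations 𝒜.feasible (𝒜.flatAt z) ↔ i ∉ 𝒜.zerosHRe z := by
  simp only [continuations, Set.mem_ofPred_eq, mem_feasible_iff]
  constructor
  · rintro ⟨X, hX, h⟩
    rwa [hX.1.insert_groundHRe_iff, hX.2.2] at h
  · intro h
    obtain ⟨X, hX⟩ := 𝒜.flatAt_nonempty z
    refine ⟨X, hX, ?_⟩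
    rwa [hX.1.insert_groundHRe_iff, hX.2.2]

theorem groundH_mem_xi_flatAt {z : Fin d → ℂ} {i : Fin n} :
    𝒜.groundH i ∈ xi (𝒜.flatAt z) ↔ i ∈ 𝒜.zerosH z := by
  constructor
  · rintro ⟨X, hX, hi⟩
    rw [← hX.2.1]
    exact subset_spanClosure _ _ hi
  · intro hi
    have hY : IsIndepPair (𝒜.ofIndex {i} {i}) :=
      ⟨by simpa using 𝒜.form_ne_zero i,
        by simpa using 𝒜.form_ne_zero i,
        by simpa [closureHRe] using subset_spanClosure (K := ℝ) 𝒜.form {i} rfl⟩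
    obtain ⟨X, hX, hYX⟩ := exists_superset_mem_flatAt hY (z := z) (by simpa using hi)
      (by simpa using zerosH_subset_zerosHRe z hi)
    exact ⟨X, hX, hYX (Or.inl ⟨i, rfl, rfl⟩)⟩

theorem groundHRe_mem_xi_flatAt {z : Fin d → ℂ} {i : Fin n} :
    𝒜.groundHRe i ∈ xi (𝒜.flatAt z) ↔ i ∈ 𝒜.zerosHRe z := by
  constructor
  · rintro ⟨X, hX, hi⟩
    rw [← hX.2.2]
    exact subset_spanClosure _ _ hi
  · intro hi
    have hY : IsIndepPair (𝒜.ofIndex ∅ {i}) :=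
      ⟨by simp,
        by simpa using 𝒜.form_ne_zero i, by simp⟩
    obtain ⟨X, hX, hYX⟩ := exists_superset_mem_flatAt hY (z := z) (by simp) (by simpa using hi)
    exact ⟨X, hX, hYX (Or.inr ⟨i, rfl, rfl⟩)⟩

/-- The feasible sets that are maximal inside the zero set of `z` have that zero set as closure. -/
theorem mu_eq_flatAt {S : Set 𝒜.ground} {z : Fin d → ℂ} (hH : indexH S = 𝒜.zerosH z)
    (hRe : indexHRe S = 𝒜.zerosHRe z) : mu 𝒜.feasible S = 𝒜.flatAt z := by
  have hmax (X : Set 𝒜.ground) (hX : Maximal (fun W => W ∈ 𝒜.feasible ∧ W ⊆ S) X) :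
      X ∈ 𝒜.flatAt z := by
    have hXi := mem_feasible_iff.1 hX.prop.1
    have hXS := subset_iff_index.1 hX.prop.2
    have hins (e : 𝒜.ground) (he : e ∈ S) : ¬ (e ∉ X ∧ IsIndepPair (insert e X)) := fun h =>
      h.1 (hX.2 ⟨mem_feasible_iff.2 h.2, Set.insert_subset he hX.prop.2⟩
        (Set.subset_insert e X) (Set.mem_insert e X))
    have hRe' : closureHRe X = 𝒜.zerosHRe z := by
      apply Set.Subset.antisymm
      · rw [← spanClosure_zerosHRe]
        exact spanClosure_mono _ (hXS.2.trans hRe.subset)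
      · intro i hi
        by_contra h
        exact hins _ (hRe.superset hi) (hXi.insert_groundHRe_iff.2 h)
    refine ⟨hXi, ?_, hRe'⟩
    apply Set.Subset.antisymm
    · rw [← spanClosure_zerosH]
      exact spanClosure_mono _ (hXS.1.trans hH.subset)
    · intro i hi
      by_contra h
      exact hins _ (hH.superset hi)
        (hXi.insert_groundH_iff.2 ⟨hRe' ▸ zerosH_subset_zerosHRe z hi, h⟩)
  obtain ⟨X, hX⟩ := (Set.toFinite {W | W ∈ 𝒜.feasible ∧ W ⊆ S}).exists_maximal
    ⟨∅, empty_mem_feasible, Set.empty_subset S⟩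
  ext Y
  constructor
  · rintro ⟨W, hW, hY⟩
    rwa [flatOf_eq_flatAt (hmax W hW)] at hY
  · intro hY
    exact ⟨X, hX, by rwa [flatOf_eq_flatAt (hmax X hX)]⟩

end RealArrangement

/-! ### Signs of real numbers -/

namespace CovSign

open Filter Topology

/-- The sign of a real number as a covector symbol. -/
noncomputable def ofReal (a : ℝ) : CovSign :=
  if 0 < a then plus else if a < 0 then minus else zero

theorem ofReal_of_pos {a : ℝ} (h : 0 < a) : ofReal a = plus := by
  simp [ofReal, h]

theorem ofReal_of_neg {a : ℝ} (h : a < 0) : ofReal a = minus := by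
  simp [ofReal, h, h.not_gt]

@[simp] theorem ofReal_zero : ofReal 0 = zero := by
  simp [ofReal]

theorem ofReal_eq_zero_iff {a : ℝ} : ofReal a = zero ↔ a = 0 := by
  rcases lt_trichotomy a 0 with h | rfl | h
  · simp [ofReal_of_neg h, h.ne]
  · simp
  · simp [ofReal_of_pos h, h.ne']

theorem ofReal_eq_plus_iff {a : ℝ} : ofReal a = plus ↔ 0 < a := by
  rcases lt_trichotomy a 0 with h | rfl | h
  · simp [ofReal_of_neg h, h.le]
  · simp
  · simp [ofReal_of_pos h, h]

theorem ofReal_eq_minus_iff {a : ℝ} : ofReal a = minus ↔ a < 0 := by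
  rcases lt_trichotomy a 0 with h | rfl | h
  · simp [ofReal_of_neg h, h]
  · simp
  · simp [ofReal_of_pos h, h.le]

theorem ofReal_ne_one (a : ℝ) : ofReal a ≠ one := by
  rcases lt_trichotomy a 0 with h | rfl | h
  · simp [ofReal_of_neg h]
  · simp
  · simp [ofReal_of_pos h]

theorem ofReal_neg (a : ℝ) : ofReal (-a) = -ofReal a := by
  rcases lt_trichotomy a 0 with h | rfl | h
  · rw [ofReal_of_neg h, ofReal_of_pos (neg_pos.2 h)]
    rfl
  · rw [neg_zero, ofReal_zero]
    rfl
  · rw [ofReal_of_pos h, ofReal_of_neg (neg_neg_of_pos h)]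
    rfl

/-- The sign of `a + εb` for infinitesimal `ε > 0`. -/
noncomputable def lexSign (a b : ℝ) : CovSign := if a = 0 then ofReal b else ofReal a

theorem ofReal_lt_ofReal_iff {a b : ℝ} : ofReal a < ofReal b ↔ a = 0 ∧ b ≠ 0 := by
  rw [lt_iff_le_and_ne]
  change (_ ∨ ofReal a = zero ∨ ofReal b = one) ∧ _ ↔ _
  simp only [ofReal_eq_zero_iff, ofReal_ne_one, or_false]
  constructor
  · rintro ⟨h | rfl, hne⟩
    · exact (hne h).elim
    · refine ⟨rfl, ?_⟩
      rintro rfl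
      exact hne rfl
  · rintro ⟨rfl, hb⟩
    refine ⟨Or.inr rfl, fun h => hb ?_⟩
    rwa [ofReal_zero, eq_comm, ofReal_eq_zero_iff] at h

theorem lexSign_eq_zero_iff {a b : ℝ} : lexSign a b = zero ↔ a = 0 ∧ b = 0 := by
  rw [lexSign]
  split_ifs with h <;> simp [ofReal_eq_zero_iff, h]

theorem eq_zero_iff_of_ofReal_eq_lexSign {a b c : ℝ} (h : ofReal c = lexSign a b) :
    c = 0 ↔ a = 0 ∧ b = 0 := by
  rw [← ofReal_eq_zero_iff, h, lexSign_eq_zero_iff]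

theorem eventually_ofReal_add_mul (a b : ℝ) :
    ∀ᶠ ε in 𝓝[>] (0 : ℝ), ofReal (a + ε * b) = lexSign a b := by
  have ht : Tendsto (fun ε : ℝ => a + ε * b) (𝓝[>] 0) (𝓝 a) := by
    refine tendsto_nhdsWithin_of_tendsto_nhds ?_
    have : Continuous fun ε : ℝ => a + ε * b := by fun_prop
    simpa using this.tendsto 0
  rcases lt_trichotomy a 0 with h | rfl | h
  · filter_upwards [ht.eventually_lt_const h] with ε hε
    rw [lexSign, if_neg h.ne, ofReal_of_neg h, ofReal_of_neg hε]
  · filter_upwards [self_mem_nhdsWithin] with ε hε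
    have hε : 0 < ε := hε
    rw [lexSign, if_pos rfl, zero_add]
    rcases lt_trichotomy b 0 with hb | rfl | hb
    · rw [ofReal_of_neg hb, ofReal_of_neg (mul_neg_of_pos_of_neg hε hb)]
    · simp
    · rw [ofReal_of_pos hb, ofReal_of_pos (mul_pos hε hb)]
  · filter_upwards [ht.eventually_const_lt h] with ε hε
    rw [lexSign, if_neg h.ne', ofReal_of_pos h, ofReal_of_pos hε]

/-- If `a` and `b` do not have opposite signs, then `a + tb` has the same sign for all `t > 0`. -/
theorem ofReal_add_mul_of_not_opposite {a b t : ℝ} (ht : 0 < t)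
    (h : ¬ (ofReal a = -ofReal b ∧ (ofReal a = plus ∨ ofReal a = minus))) :
    ofReal (a + t * b) = lexSign a b ∧ lexSign a b = lexSign b a := by
  rw [← ofReal_neg] at h
  rw [lexSign, lexSign]
  rcases lt_trichotomy a 0 with ha | rfl | ha
  · rcases lt_trichotomy b 0 with hb | rfl | hb
    · rw [if_neg ha.ne, if_neg hb.ne, ofReal_of_neg ha, ofReal_of_neg hb]
      exact ⟨ofReal_of_neg (by nlinarith), rfl⟩
    · simp [ha.ne]
    · exact (h ⟨by rw [ofReal_of_neg ha, ofReal_of_neg (neg_neg_of_pos hb)],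
        Or.inr (ofReal_of_neg ha)⟩).elim
  · rcases lt_trichotomy b 0 with hb | rfl | hb
    · simp [hb.ne, ofReal_of_neg hb, ofReal_of_neg (mul_neg_of_pos_of_neg ht hb)]
    · simp
    · simp [hb.ne', ofReal_of_pos hb, ofReal_of_pos (mul_pos ht hb)]
  · rcases lt_trichotomy b 0 with hb | rfl | hb
    · exact (h ⟨by rw [ofReal_of_pos ha, ofReal_of_pos (neg_pos.2 hb)],
        Or.inl (ofReal_of_pos ha)⟩).elim
    · simp [ha.ne']
    · rw [if_neg ha.ne', if_neg hb.ne', ofReal_of_pos ha, ofReal_of_pos hb]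
      exact ⟨ofReal_of_pos (by positivity), rfl⟩

theorem exists_pos_add_mul_eq_zero {a b : ℝ} (h : ofReal a = -ofReal b)
    (ha : ofReal a = plus ∨ ofReal a = minus) : ∃ t > 0, a + t * b = 0 := by
  rw [← ofReal_neg] at h
  have hab : a * b < 0 := by
    rcases ha with ha | ha
    · have hb := h.symm.trans ha
      rw [ofReal_eq_plus_iff] at ha hb
      exact mul_neg_of_pos_of_neg ha (neg_pos.1 hb)
    · have hb := h.symm.trans ha
      rw [ofReal_eq_minus_iff] at ha hb
      exact mul_neg_of_neg_of_pos ha (neg_neg_iff_pos.1 hb)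
  have hb0 : b ≠ 0 := by
    rintro rfl
    simp at hab
  refine ⟨-(a / b), ?_, by field_simp; ring⟩
  rw [gt_iff_lt, neg_pos, div_neg_iff]
  rwa [mul_neg_iff] at hab

end CovSign

/-! ### Sign vectors of points -/

namespace RealArrangement

open IntervalGreedoid CovSign

variable {d n : ℕ} {𝒜 : RealArrangement d n}

theorem signVector_groundHRe (z : Fin d → ℂ) (i : Fin n) :
    𝒜.signVector z (𝒜.groundHRe i) = ofReal (𝒜.imForm i z) :=
  𝒜.signVector_HRe z i

theorem signVector_groundH (z : Fin d → ℂ) (i : Fin n) :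
    𝒜.signVector z (𝒜.groundH i) =
      if 𝒜.imForm i z = 0 then ofReal (𝒜.reForm i z) else one := by
  refine (𝒜.signVector_H z i).trans ?_
  rw [sigmaRe, complexForm_re, complexForm_im, ite_not]
  rfl

theorem mem_zerosHRe {z : Fin d → ℂ} {i : Fin n} : i ∈ 𝒜.zerosHRe z ↔ 𝒜.imForm i z = 0 := Iff.rfl

theorem mem_zerosH {z : Fin d → ℂ} {i : Fin n} :
    i ∈ 𝒜.zerosH z ↔ 𝒜.imForm i z = 0 ∧ 𝒜.reForm i z = 0 :=
  𝒜.mem_H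

theorem supp_signVector (z : Fin d → ℂ) :
    supp 𝒜.feasible (𝒜.signVector z) = 𝒜.flatAt z := by
  refine mu_eq_flatAt ?_ ?_
  · ext i
    rw [mem_indexH, Set.mem_ofPred_eq, signVector_groundH, mem_zerosH]
    split_ifs with h <;> simp [h, ofReal_eq_zero_iff]
  · ext i
    rw [mem_indexHRe, Set.mem_ofPred_eq, signVector_groundHRe, mem_zerosHRe, ofReal_eq_zero_iff]

theorem signVector_mem_covectors (z : Fin d → ℂ) : 𝒜.signVector z ∈ covectors 𝒜.feasible := by
  have hofReal {a : ℝ} (ha : a ≠ 0) : ofReal a = plus ∨ ofReal a = minus := by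
    rcases ha.lt_or_gt with h | h
    · exact Or.inr (ofReal_of_neg h)
    · exact Or.inl (ofReal_of_pos h)
  have hsign : ∀ e : 𝒜.ground, e ∈ continuations 𝒜.feasible (𝒜.flatAt z) →
      𝒜.signVector z e = plus ∨ 𝒜.signVector z e = minus := by
    rw [forall_ground]
    refine ⟨fun i hi => ?_, fun i hi => ?_⟩
    · rw [groundH_mem_continuations_flatAt, mem_zerosHRe, mem_zerosH] at hi
      rw [signVector_groundH, if_pos hi.1]
      exact hofReal fun h => hi.2 ⟨hi.1, h⟩
    · rw [groundHRe_mem_continuations_flatAt, mem_zerosHRe] at hi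
      rw [signVector_groundHRe]
      exact hofReal hi
  refine ⟨⟨𝒜.flatAt z, mem_flats_iff.2 ⟨z, rfl⟩,
    fun e => ⟨𝒜.signVector z e.1, hsign e.1 e.2⟩⟩, ?_⟩
  rw [funext_iff, forall_ground]
  refine ⟨fun i => ?_, fun i => ?_⟩
  · simp only [SignedFlat.covector, groundH_mem_continuations_flatAt, groundH_mem_xi_flatAt,
      signVector_groundH, mem_zerosH, mem_zerosHRe]
    by_cases h1 : 𝒜.imForm i z = 0 <;> by_cases h2 : 𝒜.reForm i z = 0 <;> simp [h1, h2]
  · simp only [SignedFlat.covector, groundHRe_mem_continuations_flatAt, groundHRe_mem_xi_flatAt,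
      signVector_groundHRe, mem_zerosHRe]
    by_cases h1 : 𝒜.imForm i z = 0 <;> simp [h1]

theorem signVector_neg (z : Fin d → ℂ) : 𝒜.signVector (-z) = -𝒜.signVector z := by
  rw [funext_iff, forall_ground]
  refine ⟨fun i => ?_, fun i => ?_⟩
  · rw [Pi.neg_apply, signVector_groundH, signVector_groundH, map_neg, map_neg, ofReal_neg]
    simp only [neg_eq_zero]
    split_ifs <;> rfl
  · rw [Pi.neg_apply, signVector_groundHRe, signVector_groundHRe, map_neg, ofReal_neg]

/-- Moving from `z` by a small amount in the direction of `w` changes only the signs that vanish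
at `z`. -/
theorem exists_lexSign (z w : Fin d → ℂ) : ∃ u : Fin d → ℂ, ∀ i,
    ofReal (𝒜.imForm i u) = lexSign (𝒜.imForm i z) (𝒜.imForm i w) ∧
      ofReal (𝒜.reForm i u) = lexSign (𝒜.reForm i z) (𝒜.reForm i w) := by
  obtain ⟨ε, hε⟩ := (Filter.eventually_all.2 fun i =>
    (eventually_ofReal_add_mul (𝒜.imForm i z) (𝒜.imForm i w)).and
      (eventually_ofReal_add_mul (𝒜.reForm i z) (𝒜.reForm i w))).exists
  refine ⟨z + ε • w, fun i => ?_⟩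
  rw [map_add, map_add, map_smul, map_smul]
  exact hε i

theorem star_apply_ofReal {α β : 𝒜.ground → CovSign} {e : 𝒜.ground} {a b : ℝ}
    (ha : α e = ofReal a) (hb : β e = ofReal b) : IntervalGreedoid.star α β e = lexSign a b := by
  rw [IntervalGreedoid.star, ha, hb, lexSign]
  simp only [ofReal_lt_ofReal_iff]
  by_cases h1 : a = 0 <;> by_cases h2 : b = 0 <;> simp [h1, h2]

theorem comp_signVector (z w : Fin d → ℂ) :
    (∀ i, comp 𝒜.feasible (𝒜.signVector z) (𝒜.signVector w) (𝒜.groundH i) =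
      if 𝒜.imForm i z = 0 ∧ 𝒜.imForm i w = 0 then lexSign (𝒜.reForm i z) (𝒜.reForm i w)
      else one) ∧
    (∀ i, comp 𝒜.feasible (𝒜.signVector z) (𝒜.signVector w) (𝒜.groundHRe i) =
      lexSign (𝒜.imForm i z) (𝒜.imForm i w)) := by
  obtain ⟨u, hu⟩ := exists_lexSign (𝒜 := 𝒜) z w
  have him (i : Fin n) : 𝒜.imForm i u = 0 ↔ 𝒜.imForm i z = 0 ∧ 𝒜.imForm i w = 0 :=
    eq_zero_iff_of_ofReal_eq_lexSign (hu i).1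
  have hre (i : Fin n) : 𝒜.reForm i u = 0 ↔ 𝒜.reForm i z = 0 ∧ 𝒜.reForm i w = 0 :=
    eq_zero_iff_of_ofReal_eq_lexSign (hu i).2
  have hjoin : flatJoin 𝒜.feasible (𝒜.flatAt z) (𝒜.flatAt w) = 𝒜.flatAt u := by
    apply flatJoin_flatAt
    · ext i
      simp only [Set.mem_inter_iff, mem_zerosH, him, hre]
      tauto
    · ext i
      exact him i
  refine ⟨fun i => ?_, fun i => ?_⟩
  · rw [comp, supp_signVector, supp_signVector, hjoin]
    have hmem : 𝒜.groundH i ∈ continuations 𝒜.feasible (𝒜.flatAt u) ∪ xi (𝒜.flatAt u) ↔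
        𝒜.imForm i z = 0 ∧ 𝒜.imForm i w = 0 := by
      rw [Set.mem_union, groundH_mem_continuations_flatAt, groundH_mem_xi_flatAt, ← him,
        mem_zerosHRe, mem_zerosH]
      tauto
    by_cases h : 𝒜.imForm i z = 0 ∧ 𝒜.imForm i w = 0
    · rw [if_pos (hmem.2 h), if_pos h]
      exact star_apply_ofReal (by rw [signVector_groundH, if_pos h.1])
        (by rw [signVector_groundH, if_pos h.2])
    · rw [if_neg (mt hmem.1 h), if_neg h]
  · rw [comp, supp_signVector, supp_signVector, hjoin, if_pos]
    · exact star_apply_ofReal (signVector_groundHRe z i) (signVector_groundHRe w i)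
    · rw [Set.mem_union, groundHRe_mem_continuations_flatAt, groundHRe_mem_xi_flatAt]
      exact (em _).symm

theorem exists_comp_eq_signVector (z w : Fin d → ℂ) :
    ∃ u, comp 𝒜.feasible (𝒜.signVector z) (𝒜.signVector w) = 𝒜.signVector u := by
  obtain ⟨u, hu⟩ := exists_lexSign (𝒜 := 𝒜) z w
  refine ⟨u, ?_⟩
  rw [funext_iff, forall_ground]
  refine ⟨fun i => ?_, fun i => ?_⟩
  · rw [(comp_signVector z w).1, signVector_groundH, (hu i).2]
    exact if_ctx_congr (eq_zero_iff_of_ofReal_eq_lexSign (hu i).1).symm (fun _ => rfl) fun _ => rfl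
  · rw [(comp_signVector z w).2, signVector_groundHRe, (hu i).1]

/-- On the ray from `z` in the direction of `w`, all signs outside the separation set agree with
those of the composition wherever the latter is not `1`. -/
theorem signVector_add_smul {z w : Fin d → ℂ} {t : ℝ} (ht : 0 < t) (e : 𝒜.ground) :
    e ∉ separationSet (𝒜.signVector z) (𝒜.signVector w) →
    comp 𝒜.feasible (𝒜.signVector z) (𝒜.signVector w) e ≠ one →
    𝒜.signVector (z + t • w) e = comp 𝒜.feasible (𝒜.signVector z) (𝒜.signVector w) e ∧
      comp 𝒜.feasible (𝒜.signVector z) (𝒜.signVector w) e =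
        comp 𝒜.feasible (𝒜.signVector w) (𝒜.signVector z) e := by
  revert e
  rw [forall_ground]
  refine ⟨fun i hi h1 => ?_, fun i hi _ => ?_⟩
  · rw [(comp_signVector z w).1] at h1 ⊢
    rw [(comp_signVector w z).1]
    split_ifs at h1 with h
    · rw [separationSet, Set.mem_ofPred_eq, signVector_groundH, signVector_groundH, if_pos h.1,
        if_pos h.2] at hi
      rw [if_pos h, if_pos h.symm, signVector_groundH, map_add, map_add, map_smul, map_smul, h.1,
        h.2, if_pos (by simp)]
      exact ofReal_add_mul_of_not_opposite ht hi
    · exact (h1 rfl).elim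
  · rw [separationSet, Set.mem_ofPred_eq, signVector_groundHRe, signVector_groundHRe] at hi
    rw [(comp_signVector z w).2, (comp_signVector w z).2, signVector_groundHRe, map_add, map_smul]
    exact ofReal_add_mul_of_not_opposite ht hi

/-- The ray from `z` in the direction of `w` crosses the real hypersurface, or the hyperplane, that
separates `z` from `w`. -/
theorem exists_signVector_add_smul_eq_zero {z w : Fin d → ℂ} (e : 𝒜.ground) :
    e ∈ separationSet (𝒜.signVector z) (𝒜.signVector w) →
    comp 𝒜.feasible (𝒜.signVector z) (𝒜.signVector w) e ≠ one →
    ∃ t : ℝ, 0 < t ∧ 𝒜.signVector (z + t • w) e = zero := by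
  revert e
  rw [forall_ground]
  refine ⟨fun i hi h1 => ?_, fun i hi _ => ?_⟩
  · rw [(comp_signVector z w).1] at h1
    split_ifs at h1 with h
    · rw [separationSet, Set.mem_ofPred_eq, signVector_groundH, signVector_groundH, if_pos h.1,
        if_pos h.2] at hi
      obtain ⟨t, ht, h0⟩ := exists_pos_add_mul_eq_zero hi.1 hi.2
      refine ⟨t, ht, ?_⟩
      rw [signVector_groundH, map_add, map_add, map_smul, map_smul, h.1, h.2, if_pos (by simp),
        ofReal_eq_zero_iff]
      exact h0
    · exact (h1 rfl).elim
  · rw [separationSet, Set.mem_ofPred_eq, signVector_groundHRe, signVector_groundHRe] at hi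
    obtain ⟨t, ht, h0⟩ := exists_pos_add_mul_eq_zero hi.1 hi.2
    refine ⟨t, ht, ?_⟩
    rw [signVector_groundHRe, map_add, map_smul, ofReal_eq_zero_iff]
    exact h0

theorem isOrientedIntervalGreedoid_signVector :
    IsOrientedIntervalGreedoid 𝒜.feasible {α | ∃ z : Fin d → ℂ, α = 𝒜.signVector z} where
  isIntervalGreedoid := 𝒜.isIntervalGreedoid_feasible
  subset_covectors := by
    rintro _ ⟨z, rfl⟩
    exact signVector_mem_covectors z
  supp_surjective A hA := by
    obtain ⟨z, rfl⟩ := mem_flats_iff.1 hA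
    exact ⟨_, ⟨z, rfl⟩, supp_signVector z⟩
  neg_mem := by
    rintro _ ⟨z, rfl⟩
    exact ⟨-z, (signVector_neg z).symm⟩
  comp_mem := by
    rintro _ ⟨z, rfl⟩ _ ⟨w, rfl⟩
    exact exists_comp_eq_signVector z w
  elimination := by
    rintro _ ⟨z, rfl⟩ _ ⟨w, rfl⟩ e he h1
    obtain ⟨t, ht, h0⟩ := exists_signVector_add_smul_eq_zero e he h1
    exact ⟨_, ⟨z + t • w, rfl⟩, h0, signVector_add_smul ht⟩

end RealArrangement

theorem mainTheorem10 {d n : ℕ} (𝒜 : RealArrangement d n) :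
    (Finite 𝒜.IntersectionLattice ∧ IsWeakLowerModularLattice 𝒜.IntersectionLattice ∧
      {M : 𝒜.IntersectionLattice | InfIrred M} = Set.range 𝒜.toLattice) ∧
    IntervalGreedoid.IsOrientedIntervalGreedoid 𝒜.feasible
      {α | ∃ z : Fin d → ℂ, α = 𝒜.signVector z} :=
  ⟨⟨𝒜.finite_intersectionLattice, RealArrangement.isWeakLowerModularLattice_intersectionLattice,
    𝒜.setOf_infIrred_eq_range_toLattice⟩, RealArrangement.isOrientedIntervalGreedoid_signVector⟩
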